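/- **Setting.** For sets $X,Y$, a relation $R\subseteq X\times Y$ is *co-bijective* if every $y\in Y$ is related to some $x$, and every $x\in X$ has some $y$ with $xRy$ that is related to no other element of $X$; that is, the sets $[x]_R=\{y: xRy\}$ form a minimal cover of $Y$. Co-bijective relations are called *co-valuations* on $Y$ in $X$, and $\mathrm{Val}(X,Y)$ is their set. For $\geq\,\in \mathrm{Val}(X,Y)$ and $w\in \mathrm{Val}(Y,M)$, $C_\geq(w)=\,\geq\circ\, w\in\mathrm{Val}(X,M)$ is the *consolidation* of $w$ with pattern $\geq$, and $w$ is a *fragmentation* of it. A *context* is a finite set of variables from a countable set containing a variable $*$. Let $L$ be a relational signature. Formulas in context $X$ are generated by $\bot$, $R(\bar x)$ ($\bar x$ a tuple in $X$), $\neg$, $\wedge$ and $\exists^{\rm fr}_\geq\phi$, where $\geq\,\in \mathrm{Val}(X,Y)$ and $\phi$ is a formula in context $Y$. Sentences are formulas in context $\{*\}$; a theory is a set of sentences. A *structure* $(M,V)$ is a non-empty first-order $L$-structure $M$ with a non-empty family $V$ of co-valuations on $M$ in contexts, closed under consolidations by contexts, such that (I) any $u,v\in V$ have a common fragmentation in $V$;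 (II) if $v\in V$ and $R^M\cap\prod_k[x_k]_v\neq\emptyset$, then there are $w\in V$, a tuple $\bar y$ in the context of $w$ with $[y_k]_w\subseteq[x_k]_v$ for all $k$, and $\bar a\in R^M$ such that $y_k$ is the only element of the context of $w$ with $a_k\in[y_k]_w$. Satisfaction is given by $M\models_v R(\bar x)$ iff $R^M\cap\prod_k[x_k]_v\ne\emptyset$, the usual clauses for $\bot,\neg,\wedge$, and $M\models_v\exists^{\rm fr}_\geq\phi$ iff there is $w\in V$ with $v=C_\geq(w)$ and $M\models_w\phi$. A structure is an *$\omega$-structure* if there are $v_i\in V$ ($i\in\mathbb N$), each $v_i$ a consolidation of $v_{i+1}$, such that $V=\langle\{v_i\}\rangle$, i.e. every $v\in V$ is a consolidation of some $v_i$; such a $(v_i)$ is called a *core*. It is *compact* if there is a compact $T_1$ topology on $M$ for which the sets $[x]_v$, $v\in V$, are open, every open cover is refined by $\{[x]_v\}_x$ for some $v\in V$, and all $R^M$ are closed. A type $p$ in context $X$ is a set of formulas in context $X$; it is realized in $(M,V)$ if some $v\in V$ in context $X$ satisfies all of it. For a theory $T$ and a context $X$ of size $n$, $S_n(T)$ is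 the set of all complete types in context $X$ (containing $\phi$ or $\neg\phi$ for each $\phi$) that are realized in models of $T$ (structures satisfying $T$), with the topology generated by the sets $[\phi]=\{p:\phi\in p\}$. Fix contexts $X_i$ with $|X_0|=1$, $|X_{i+1}|=2^{|X_i|}$, and let $\mathbb P=\bigsqcup_i X_i$. Let $\mathrm{Mod}(L)$ be the set of pairs $\mu=(\geq_\mu,b)$ such that (1) $\geq_\mu$ is a relation on $\mathbb P$ that is the reflexive and transitive closure of its restrictions to $X_i\times X_{i+1}$, $i\in\mathbb N$, and these restrictions are co-bijective; (2) $b$ assigns to every $R\in L$ a set $b_R$ of tuples (of length the arity of $R$), each lying in some $X_i$, such that if $\bar y\in b_R$ and $x_k\geq_\mu y_k$ for all $k$, where $\bar x$ is a tuple in some $X_j$, then $\bar x\in b_R$. For $\mu \in \mathrm{Mod}(L)$, a *band* is a finite subset of $\mathbb P$ such that every $p\in\mathbb P$ is comparable with one of its elements; a *cap* is a set $C\subseteq\mathbb P$ such that, for some band $B$, every $b\in B$ is $\leq_\mu c$ for some $c\in C$; a *selector* is a subset of $\mathbb P$ that meets every cap. The compact $\omega$-structure $M_\mu$ has as universe the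 set of all minimal selectors $S$, core $v_i=\{(x,S): x\in X_i\cap S\}\in \mathrm{Val}(X_i,M_\mu)$ and $V=\langle\{v_i\}\rangle$, and $R(S_1,\dots,S_m)$ holds iff $\bar x\in b_R$ for all tuples $\bar x$ in some $X_i$ with $x_k\in S_k$ for all $k$. The *logic topology* on $\mathrm{Mod}(L)$ is generated by the sets $\{\mu: \geq_\mu \text{ agrees with } g \text{ on } \bigsqcup_{i'\le i}X_{i'}\}$ ($g$ a binary relation) and $\{\mu: M_\mu\models_{v_i}\phi\}$ ($i\in\mathbb N$, $\phi$ a formula in context $X_i$). $\mathrm{Mod}(T)\subseteq \mathrm{Mod}(L)$ is the subspace of all $\mu$ such that $M_\mu$ is a model of $T$. Let $\mathrm{Mod}^*(T)\subseteq \mathrm{Mod}(T)$ be the subspace of those $\mu$ for which $b$ is exactly the atomic diagram of the core: $\bar x\in b_R$ iff $M_\mu\models_{v_i}R(\bar x)$, for all $R$, $i$ and $\bar x$ in $X_i$. **Theorem.** Let $T$ be a theory in a countable relational signature all of whose compact $\omega$-models are infinite, and let $p\in S_n(T)$. Consider: 1. $p$ is an isolated point of $S_n(T)$; 2. $p$ is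 realized in every model of $T$; 2'. $p$ is realized in every compact $\omega$-model of $T$; 3. for some $i\in\mathbb N$ and some $\geq\,\in \mathrm{Val}(X,X_i)$, the set of $\mu\in \mathrm{Mod}(T)$ such that $C_\geq(v_i)$ realizes $p$ in $M_\mu$ has non-empty interior in $\mathrm{Mod}(T)$; 3'. the same as 3, with $\mathrm{Mod}^*(T)$ in place of $\mathrm{Mod}(T)$. If $T$ is complete (every sentence is either true in all models of $T$ or false in all models of $T$), then 1, 2, 2', 3 and 3' are equivalent. For arbitrary such $T$, 1, 3 and 3' are equivalent, and 2' (hence also 2) implies 1. -/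

import Mathlib

universe uf ur u

namespace CovLogic

/-! ### Relations and co-valuations -/

/-- The relation `π_R`: `x` is related to those `y` whose only `R`-predecessor is `x`. -/
def Priv {X Y : Type*} (R : X → Y → Prop) (x : X) (y : Y) : Prop :=
  R x y ∧ ∀ x', R x' y → x' = x

/-- Co-bijective relations, i.e. `π_R` is surjective and every `y` is related to some `x`
(equivalently, the sets `[x]_R = {y | R x y}` form a minimal cover of `Y` indexed by `X`).
A co-valuation on `Y` in `X` is a co-bijective relation. -/
structure CoBijective {X Y : Type*} (R : X → Y → Prop) : Prop where
  coinj : ∀ x, ∃ y, Priv R x y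
  cosurj : ∀ y, ∃ x, R x y

theorem CoBijective.comp {X Y Z : Type*} {R : X → Y → Prop} {S : Y → Z → Prop}
    (hR : CoBijective R) (hS : CoBijective S) : CoBijective (Relation.Comp R S) := by
  refine ⟨fun x => ?_, fun z => ?_⟩
  · obtain ⟨y, hy, hy'⟩ := hR.coinj x
    obtain ⟨z, hz, hz'⟩ := hS.coinj y
    refine ⟨z, ⟨y, hy, hz⟩, ?_⟩
    rintro x' ⟨y', h1, h2⟩
    obtain rfl := hz' y' h2
    exact hy' x' h1
  · obtain ⟨y, hy⟩ := hS.cosurj z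
    obtain ⟨x, hx⟩ := hR.cosurj y
    exact ⟨x, y, hx, hy⟩

/-- `v` is a consolidation of `w` (and `w` a fragmentation of `v`): `v = C_≥(w) = ≥ ∘ w` for some
consolidation pattern `≥`, a co-valuation on `Y` in `X`. -/
def Consolidates {X Y M : Type*} (v : X → M → Prop) (w : Y → M → Prop) : Prop :=
  ∃ r : X → Y → Prop, CoBijective r ∧ v = Relation.Comp r w

/-! ### Formulas. Variables are natural numbers, contexts are finite sets of variables, and the
distinguished variable `*` is `0`. -/

/-- The context `{*}` of sentences. -/
def starCtx : Finset ℕ := {0}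

/-- Formulas in context `X` over the relational signature `L`; `ex r φ` is the quantifier
`∃^fr_≥ φ` with consolidation pattern `≥ := r`, a co-valuation on `Y` in `X`. -/
inductive Formula (L : FirstOrder.Language.{uf, ur}) : Finset ℕ → Type ur
  | bot {X : Finset ℕ} : Formula L X
  | rel {X : Finset ℕ} {m : ℕ} (R : L.Relations m) (x : Fin m → X) : Formula L X
  | neg {X : Finset ℕ} (φ : Formula L X) : Formula L X
  | and {X : Finset ℕ} (φ ψ : Formula L X) : Formula L X
  | ex {X Y : Finset ℕ} (r : X → Y → Prop) (hr : CoBijective r) (φ : Formula L Y) : Formula L X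

/-! ### Proto-structures, satisfaction, structures -/

/-- A proto-structure: a first-order structure together with a family `V` of (admissible)
co-valuations in contexts, closed under consolidations by contexts. -/
structure ProtoStructure (L : FirstOrder.Language.{uf, ur}) where
  carrier : Type u
  str : L.Structure carrier
  V : ∀ X : Finset ℕ, Set (X → carrier → Prop)
  coval : ∀ {X : Finset ℕ} {v : X → carrier → Prop}, v ∈ V X → CoBijective v
  closed : ∀ {X Y : Finset ℕ} (r : X → Y → Prop) {w : Y → carrier → Prop},
    CoBijective r → w ∈ V Y → Relation.Comp r w ∈ V X

/-- The interpretation of a relation symbol. -/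
def ProtoStructure.Holds {L : FirstOrder.Language.{uf, ur}} (M : ProtoStructure.{uf, ur, u} L)
    {m : ℕ} (R : L.Relations m) (a : Fin m → M.carrier) : Prop :=
  M.str.RelMap R a

/-- The satisfaction relation `M ⊨_v φ`. -/
def ProtoStructure.Sat {L : FirstOrder.Language.{uf, ur}} (M : ProtoStructure.{uf, ur, u} L) :
    {X : Finset ℕ} → Formula L X → (X → M.carrier → Prop) → Prop
  | _, .bot, _ => False
  | _, .rel R x, v => ∃ a, (∀ k, v (x k) (a k)) ∧ M.Holds R a
  | _, .neg φ, v => ¬ M.Sat φ v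
  | _, .and φ ψ, v => M.Sat φ v ∧ M.Sat ψ v
  | _, .ex (Y := Y) r _ φ, v => ∃ w ∈ M.V Y, v = Relation.Comp r w ∧ M.Sat φ w

/-- Structures: proto-structures with non-empty universe that satisfy Axiom (I), `V` is directed
(in particular non-empty), and Axiom (II). -/
structure ProtoStructure.IsStructure {L : FirstOrder.Language.{uf, ur}}
    (M : ProtoStructure.{uf, ur, u} L) : Prop where
  nonempty : Nonempty M.carrier
  admissible_nonempty : ∃ X, (M.V X).Nonempty
  directed : ∀ {X Y : Finset ℕ}, ∀ v ∈ M.V X, ∀ w ∈ M.V Y,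
    ∃ Z, ∃ z ∈ M.V Z, Consolidates v z ∧ Consolidates w z
  witness : ∀ {m : ℕ} (R : L.Relations m) {X : Finset ℕ}, ∀ v ∈ M.V X, ∀ x : Fin m → X,
    M.Sat (.rel R x) v →
      ∃ (Y : Finset ℕ) (w : Y → M.carrier → Prop) (y : Fin m → Y) (a : Fin m → M.carrier),
        w ∈ M.V Y ∧ (∀ k, Priv w (y k) (a k)) ∧ (∀ k b, w (y k) b → v (x k) b) ∧ M.Holds R a

/-- `M` is a structure satisfying every sentence of the theory `T` (in a structure there is exactly
one admissible co-valuation in context `{*}`). -/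
def ProtoStructure.IsModel {L : FirstOrder.Language.{uf, ur}} (M : ProtoStructure.{uf, ur, u} L)
    (T : Set (Formula L starCtx)) : Prop :=
  M.IsStructure ∧ ∃ v ∈ M.V starCtx, ∀ φ ∈ T, M.Sat φ v

/-- The type `p` is realized in `M`. -/
def ProtoStructure.Realizes {L : FirstOrder.Language.{uf, ur}} (M : ProtoStructure.{uf, ur, u} L)
    {X : Finset ℕ} (p : Set (Formula L X)) : Prop :=
  ∃ v ∈ M.V X, ∀ φ ∈ p, M.Sat φ v

/-- `V` is generated by an `ω`-chain `(v_i)` of admissible co-valuations. -/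
def ProtoStructure.IsOmega {L : FirstOrder.Language.{uf, ur}}
    (M : ProtoStructure.{uf, ur, u} L) : Prop :=
  ∃ (C : ℕ → Finset ℕ) (v : ∀ i, C i → M.carrier → Prop),
    (∀ i, v i ∈ M.V (C i)) ∧ (∀ i, Consolidates (v i) (v (i + 1))) ∧
      ∀ X, ∀ u ∈ M.V X, ∃ i, Consolidates u (v i)

/-- There is a compact `T₁` topology on the universe such that admissible co-valuations are open
covers, every open cover is refined by an admissible co-valuation, and the relations are closed. -/
def ProtoStructure.IsCompact {L : FirstOrder.Language.{uf, ur}}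
    (M : ProtoStructure.{uf, ur, u} L) : Prop :=
  ∃ _ : TopologicalSpace M.carrier, CompactSpace M.carrier ∧ T1Space M.carrier ∧
    (∀ X, ∀ v ∈ M.V X, ∀ x, IsOpen {a | v x a}) ∧
    (∀ 𝒰 : Set (Set M.carrier), (∀ U ∈ 𝒰, IsOpen U) → ⋃₀ 𝒰 = Set.univ →
      ∃ X, ∃ v ∈ M.V X, ∀ x, ∃ U ∈ 𝒰, {a | v x a} ⊆ U) ∧
    ∀ {m : ℕ} (R : L.Relations m), IsClosed {a : Fin m → M.carrier | M.Holds R a}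

/-- Compact `ω`-models of `T`. -/
def ProtoStructure.IsCompactOmegaModel {L : FirstOrder.Language.{uf, ur}}
    (M : ProtoStructure.{uf, ur, u} L) (T : Set (Formula L starCtx)) : Prop :=
  M.IsModel T ∧ M.IsCompact ∧ M.IsOmega

/-- `T` is complete: every sentence is true in all models of `T` or false in all models of `T`. -/
def CompleteTheory {L : FirstOrder.Language.{uf, ur}} (T : Set (Formula L starCtx)) : Prop :=
  ∀ σ : Formula L starCtx,
    (∀ M : ProtoStructure.{uf, ur, u} L, M.IsModel T → M.IsModel {σ}) ∨
    (∀ M : ProtoStructure.{uf, ur, u} L, M.IsModel T → M.IsModel {σ.neg})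

/-! ### Type spaces -/

/-- The type space `S_n(T)` for the context `X` of size `n`: complete types in context `X` that are
realized in some model of `T`. -/
def TypeSpace {L : FirstOrder.Language.{uf, ur}} (T : Set (Formula L starCtx)) (X : Finset ℕ) :
    Type ur :=
  {p : Set (Formula L X) // (∀ φ, φ ∈ p ∨ φ.neg ∈ p) ∧
    ∃ M : ProtoStructure.{uf, ur, u} L, M.IsModel T ∧ M.Realizes p}

/-- The logic topology on the type space, generated by the sets `[φ] = {p | φ ∈ p}`. -/
instance {L : FirstOrder.Language.{uf, ur}} (T : Set (Formula L starCtx)) (X : Finset ℕ) :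
    TopologicalSpace (TypeSpace.{uf, ur, u} T X) :=
  TopologicalSpace.generateFrom {U | ∃ φ : Formula L X, U = {p | φ ∈ p.1}}

/-! ### The spectrum of a poset -/

/-- Bands: finite sets `B` such that every element is comparable with an element of `B`. -/
def IsBand {P : Type*} (ge : P → P → Prop) (B : Set P) : Prop :=
  B.Finite ∧ ∀ p, ∃ b ∈ B, ge p b ∨ ge b p

/-- Caps: sets that are refined by a band. -/
def IsCap {P : Type*} (ge : P → P → Prop) (C : Set P) : Prop :=
  ∃ B, IsBand ge B ∧ ∀ b ∈ B, ∃ c ∈ C, ge c b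

/-- Selectors: sets that meet every cap. -/
def IsSelector {P : Type*} (ge : P → P → Prop) (S : Set P) : Prop :=
  ∀ C, IsCap ge C → (S ∩ C).Nonempty

/-- The spectrum: the set of all minimal selectors. -/
def Spectrum {P : Type*} (ge : P → P → Prop) : Type _ :=
  {S : Set P // Minimal (IsSelector ge) S}

/-! ### The space of infinite compact `ω`-structures -/

/-- `|X_0| = 1`, `|X_{i+1}| = 2 ^ |X_i|`. -/
def levelCard : ℕ → ℕ
  | 0 => 1
  | i + 1 => 2 ^ levelCard i

/-- The contexts `X_i`. -/
def level (i : ℕ) : Finset ℕ := Finset.range (levelCard i)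

/-- The disjoint union of the contexts `X_i`. -/
abbrev Levels : Type := Σ i, level i

/-- Pairs `(a, b)`, where `a` is a binary relation on the disjoint union of the `X_i` (written as
`ge`) and `b R` is a set of tuples in the `X_i`, of length the arity of `R`. -/
structure Code (L : FirstOrder.Language.{uf, ur}) where
  ge : Levels → Levels → Prop
  b : ∀ {m : ℕ}, L.Relations m → ∀ i, (Fin m → level i) → Prop

/-- `ge` is the order of an `ω`-chain with levels `X_i`: the reflexive and transitive closure of its
restrictions to `X_i × X_{i+1}`, and the latter are co-bijective. -/
def IsChainOrder (ge : Levels → Levels → Prop) : Prop :=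
  (∀ p q, ge p q ↔ Relation.ReflTransGen (fun s t => t.1 = s.1 + 1 ∧ ge s t) p q) ∧
    ∀ i, CoBijective (fun (x : level i) (y : level (i + 1)) => ge ⟨i, x⟩ ⟨i + 1, y⟩)

/-- The defining conditions of `Mod(L)`: `ge` is the order of an `ω`-chain with co-bijective bonding
relations, and `b` is monotone. -/
structure Code.IsCode {L : FirstOrder.Language.{uf, ur}} (μ : Code L) : Prop where
  chain : IsChainOrder μ.ge
  mono : ∀ {m : ℕ} (R : L.Relations m) (i j : ℕ) (y : Fin m → level i) (x : Fin m → level j),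
    μ.b R i y → (∀ k, μ.ge ⟨j, x k⟩ ⟨i, y k⟩) → μ.b R j x

/-- The co-valuation `v_i` on the spectrum: `(x, S) ∈ v_i` iff `x ∈ S`. -/
def Code.core {L : FirstOrder.Language.{uf, ur}} (μ : Code L) (i : ℕ) (x : level i)
    (S : Spectrum μ.ge) : Prop :=
  (⟨i, x⟩ : Levels) ∈ S.1

/-- The compact `ω`-structure `M_μ` on the spectrum, with `V` generated by the `v_i`. (The clause
`CoBijective v` holds automatically when `μ.ge` is a chain order.) -/
def Code.model {L : FirstOrder.Language.{uf, ur}} [L.IsRelational] (μ : Code L) :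
    ProtoStructure.{uf, ur, 0} L where
  carrier := Spectrum μ.ge
  str := { RelMap := fun R S => ∀ i (x : _ → level i), (∀ k, μ.core i (x k) (S k)) → μ.b R i x }
  V X := {v | CoBijective v ∧ ∃ (i : ℕ) (r : X → level i → Prop),
    CoBijective r ∧ v = Relation.Comp r (μ.core i)}
  coval h := h.1
  closed := by
    rintro X Y r w hr ⟨hw, i, s, hs, rfl⟩
    exact ⟨hr.comp hw, i, Relation.Comp r s, hr.comp hs, Relation.comp_assoc.symm⟩

/-- `Mod(L)`. -/
def Mod (L : FirstOrder.Language.{uf, ur}) : Set (Code L) := {μ | μ.IsCode}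

/-- The elements of `Mod(L)` whose second coordinate is the list of all atomic formulas true at the
`v_i`, i.e. the codes `μ_M` of infinite compact `ω`-structures `M` with a given core. -/
def ModExact (L : FirstOrder.Language.{uf, ur}) [L.IsRelational] : Set (Code L) :=
  {μ | μ.IsCode ∧ ∀ {m : ℕ} (R : L.Relations m) (i : ℕ) (x : Fin m → level i),
    μ.b R i x ↔ μ.model.Sat (.rel R x) (μ.core i)}

/-- The logic topology, with sub-basic open sets `[i, ≥]` and `[i, φ]`; subsets of `Code L` such as
`Mod(L)` carry the subspace topology, generated by the traces of these sets. -/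
instance {L : FirstOrder.Language.{uf, ur}} [L.IsRelational] : TopologicalSpace (Code L) :=
  TopologicalSpace.generateFrom
    ({U | ∃ (i : ℕ) (g : Levels → Levels → Prop),
        U = {μ | ∀ x y : Levels, x.1 ≤ i → y.1 ≤ i → (μ.ge x y ↔ g x y)}} ∪
      {U | ∃ (i : ℕ) (φ : Formula L (level i)), U = {μ | μ.model.Sat φ (μ.core i)}})

/-- For a set `K` of codes and a theory `T`: the space of all `μ ∈ K` such that `M_μ` is a model
of `T`. -/
def ModelsIn {L : FirstOrder.Language.{uf, ur}} [L.IsRelational] (K : Set (Code L))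
    (T : Set (Formula L starCtx)) : Set (Code L) :=
  {μ | μ ∈ K ∧ μ.model.IsModel T}

/-- For some `i` and some pattern `≥`, the set of `μ` such that `C_≥(v_i)` realizes `p` in `M_μ` has
non-empty interior in the space of all `μ ∈ K` with `M_μ` a model of `T`. -/
def SomewhereRealized {L : FirstOrder.Language.{uf, ur}} [L.IsRelational] (K : Set (Code L))
    (T : Set (Formula L starCtx)) {X : Finset ℕ} (p : Set (Formula L X)) : Prop :=
  ∃ (i : ℕ) (r : X → level i → Prop), CoBijective r ∧
    (interior {μ : ModelsIn K T |
      ∀ φ ∈ p, μ.1.model.Sat φ (Relation.Comp r (μ.1.core i))}).Nonempty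

end CovLogic

/-!
The proof is by omitting types, in the form of forcing with formulas. A condition (`Cond`) is a
finite piece of information about a core `v_0, v_1, …` of a model of `T`: the bonds between
consecutive levels up to `j`, and one formula to be true at `v_j`. It has to be realized in some
model of `T`, of any size and with any family of admissible co-valuations. A sufficiently generic
sequence of conditions determines a code `μ`, where `b` consists of the atomic formulas that are
forced; the truth lemma `IsGeneric.sat_iff_forced` says that `M_μ` satisfies what is forced, so
that `M_μ` is a compact `ω`-model of `T` and `μ ∈ Mod*(T)`. This replaces both a Löwenheim–Skolem
theorem and the Baire category theorem for `Mod(T)`.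

Three facts make the requirements dense.
* A chain in a model can be continued to a common fragmentation with any given admissible
  co-valuation (`Cond.exists_continuation`). The prescribed sizes of the levels are met because
  co-bijective relations between finite sets factor through all intermediate sizes
  (`CoBijective.interpolate`), and because admissible co-valuations of models of `T` have
  unbounded size (`exists_large_coval`): otherwise there is a finest one, whose context carries a
  finite compact `ω`-model of `T`.
* Satisfaction at a consolidation of `v` is expressed by a formula at `v` (`exists_subst`).
* The witnesses of atomic formulas required by Axiom (II) leave a trace expressible by a formula
  (`ProtoStructure.PrivatelyRelated`). Conversely, from this trace a limit along an ultrafilter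
  produces points of the spectrum (`Code.exists_holds_of_private`).

If `p` is not isolated, then for every pattern and every member of the core the conditions forcing
the negation of some formula of `p` are dense, so that a generic compact `ω`-model omits `p`
(`isOpen_of_forall_realizes`). If `φ` isolates `p`, then `p` is realized throughout a basic open
set given by `φ`, and a generic code shows that this set is non-empty
(`somewhereRealized_of_isOpen`). Conversely, a basic open set on which `p` is realized is given,
near each of its members, by finitely many bonds and one formula `ψ` at `v_j`
(`exists_basic_nhd`). Then `∃^fr ψ` isolates `p`, since a model in which it holds at a
co-valuation not realizing `p` gives a condition whose generic codes lie in the open set but do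
not realize `p` (`isOpen_of_somewhereRealized`).
-/

namespace CovLogic

open Relation Filter Topology

variable {L : FirstOrder.Language.{uf, ur}}

/-! ### Co-bijective relations -/

theorem CoBijective.eq {X : Type*} : CoBijective (Eq : X → X → Prop) :=
  ⟨fun x => ⟨x, rfl, fun _ h => h⟩, fun x => ⟨x, rfl⟩⟩

/-- The relation `c ↦ e⁻¹(c)` of a surjection `e` is co-bijective; consolidating along it merges
the elements with the same image. -/
theorem CoBijective.fibre {X Y : Type*} {e : X → Y} (he : Function.Surjective e) :
    CoBijective (fun (y : Y) (x : X) => e x = y) := by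
  refine ⟨fun y => ?_, fun x => ⟨e x, rfl⟩⟩
  obtain ⟨x, rfl⟩ := he y
  exact ⟨x, rfl, fun _ h => h.symm⟩

theorem comp_apply_of_priv {X Y Z : Type*} {r : X → Y → Prop} {v : Y → Z → Prop} {x : X} {y : Y}
    {z : Z} (h : Priv v y z) : Comp r v x z ↔ r x y := by
  constructor
  · rintro ⟨y', h1, h2⟩
    obtain rfl := h.2 y' h2
    exact h1
  · exact fun h1 => ⟨y, h1, h.1⟩

theorem comp_mono_iff {X X' Y Z : Type*} {r : X → Y → Prop} {s : X' → Y → Prop}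
    {v : Y → Z → Prop} (hv : CoBijective v) {x : X} {x' : X'} :
    (∀ z, Comp r v x z → Comp s v x' z) ↔ ∀ y, r x y → s x' y := by
  constructor
  · intro h y hy
    obtain ⟨z, hz⟩ := hv.coinj y
    exact (comp_apply_of_priv hz).1 (h z ((comp_apply_of_priv hz).2 hy))
  · rintro h z ⟨y, h1, h2⟩
    exact ⟨y, h y h1, h2⟩

/-- Consolidation patterns of a co-valuation can be cancelled, since every element of its context
has a private point. -/
theorem comp_right_cancel {X Y Z : Type*} {r s : X → Y → Prop} {v : Y → Z → Prop}
    (hv : CoBijective v) (h : Comp r v = Comp s v) : r = s := by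
  funext x y
  obtain ⟨z, hz⟩ := hv.coinj y
  rw [← comp_apply_of_priv (r := r) (x := x) hz, h, comp_apply_of_priv hz]

theorem CoBijective.of_comp {X Y Z : Type*} {r : X → Y → Prop} {v : Y → Z → Prop}
    (hv : CoBijective v) (h : CoBijective (Comp r v)) : CoBijective r := by
  refine ⟨fun x => ?_, fun y => ?_⟩
  · obtain ⟨z, ⟨y, h1, h2⟩, h3⟩ := h.coinj x
    exact ⟨y, h1, fun x' hx' => h3 x' ⟨y, hx', h2⟩⟩
  · obtain ⟨z, hz⟩ := hv.coinj y
    obtain ⟨x, hx⟩ := h.cosurj z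
    exact ⟨x, (comp_apply_of_priv hz).1 hx⟩

/-- A choice of private points embeds `X` into `Y`. -/
theorem CoBijective.exists_injective {X Y : Type*} {r : X → Y → Prop} (hr : CoBijective r) :
    ∃ f : X → Y, Function.Injective f ∧ ∀ x, Priv r x (f x) := by
  choose f hf using hr.coinj
  refine ⟨f, fun x y hxy => ?_, hf⟩
  exact (hf y).2 x (hxy ▸ (hf x).1)

theorem CoBijective.card_le {X Y : Type*} [Finite Y] {r : X → Y → Prop}
    (hr : CoBijective r) : Nat.card X ≤ Nat.card Y := by
  obtain ⟨f, hf, -⟩ := hr.exists_injective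
  exact Nat.card_le_card_of_injective f hf

/-- Between finite sets of the same size a co-bijective relation is a bijection; in particular
it has a co-bijective inverse. -/
theorem CoBijective.exists_inverse {X Y : Type*} [Finite X] [Finite Y] {r : X → Y → Prop}
    (hr : CoBijective r) (h : Nat.card Y ≤ Nat.card X) :
    ∃ s : Y → X → Prop, CoBijective s ∧ Comp s r = Eq := by
  obtain ⟨f, hf, hp⟩ := hr.exists_injective
  have hs : Function.Surjective f :=
    ((Nat.bijective_iff_injective_and_card f).2
      ⟨hf, le_antisymm (Nat.card_le_card_of_injective f hf) h⟩).2
  refine ⟨fun y x => f x = y, .fibre hs, ?_⟩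
  funext y z
  obtain ⟨x, rfl⟩ := hs z
  refine propext ⟨?_, ?_⟩
  · rintro ⟨x', rfl, h2⟩
    rw [(hp x).2 x' h2]
  · rintro rfl
    exact ⟨x, rfl, (hp x).1⟩

/-- Interpolation: a co-bijective relation between finite sets factors through every finite set of
intermediate size. -/
theorem CoBijective.interpolate {X Y Z : Type*} [Finite X] [Finite Y] [Finite Z] {r : X → Z → Prop}
    (hr : CoBijective r) (h1 : Nat.card X ≤ Nat.card Y) (h2 : Nat.card Y ≤ Nat.card Z) :
    ∃ (s : X → Y → Prop) (t : Y → Z → Prop), CoBijective s ∧ CoBijective t ∧ r = Comp s t := by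
  classical
  have := Fintype.ofFinite X
  have := Fintype.ofFinite Y
  have := Fintype.ofFinite Z
  simp only [Nat.card_eq_fintype_card] at h1 h2
  obtain ⟨f, hf, hp⟩ := hr.exists_injective
  -- The middle set is a set of points of `Z` containing a private point of each `x`; an element of
  -- it keeps its own point and, if it is the private point of `x`, all of `[x]` outside the set.
  obtain ⟨E, hfE, -, hE⟩ := Finset.exists_subsuperset_card_eq
    (Finset.subset_univ (Finset.univ.image f)) (n := Fintype.card Y)
    (by rwa [Finset.card_image_of_injective _ hf]) (by simpa using h2)
  have hfE' : ∀ x, f x ∈ E := fun x => hfE (by simp)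
  have e : Y ≃ E := Fintype.equivOfCardEq (by simpa using hE.symm)
  refine ⟨fun x y => r x (e y), fun y z => (e y : Z) = z ∨ z ∉ E ∧ ∃ x, (e y : Z) = f x ∧ r x z,
    ⟨fun x => ?_, fun y => hr.cosurj _⟩, ⟨fun y => ?_, fun z => ?_⟩, ?_⟩
  · refine ⟨e.symm ⟨f x, hfE' x⟩, ?_⟩
    simpa [Priv] using hp x
  · refine ⟨e y, Or.inl rfl, ?_⟩
    rintro y' (h | ⟨h, -⟩)
    · exact e.injective (Subtype.ext h)
    · exact absurd (e y).2 h
  · by_cases hz : z ∈ E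
    · exact ⟨e.symm ⟨z, hz⟩, Or.inl (by simp)⟩
    · obtain ⟨x, hx⟩ := hr.cosurj z
      exact ⟨e.symm ⟨f x, hfE' x⟩, Or.inr ⟨hz, x, by simp, hx⟩⟩
  · funext x z
    refine propext ⟨fun h => ?_, ?_⟩
    · by_cases hz : z ∈ E
      · exact ⟨e.symm ⟨z, hz⟩, by simpa using h, Or.inl (by simp)⟩
      · exact ⟨e.symm ⟨f x, hfE' x⟩, by simpa using (hp x).1, Or.inr ⟨hz, x, by simp, h⟩⟩
    · rintro ⟨y, h, h' | ⟨-, x', h3, h4⟩⟩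
      · rwa [h'] at h
      · rw [h3] at h
        obtain rfl := (hp x').2 x h
        exact h4

theorem card_range (n : ℕ) : Nat.card (Finset.range n) = n := by
  rw [Nat.card_eq_fintype_card, Fintype.card_coe, Finset.card_range]

/-- Grouping the elements of `U` by their `r`-predecessors bounds the size of the right-hand side
of a relation in terms of the left-hand side. -/
theorem exists_grouping {ι U : Type*} [Finite ι] [Finite U] (r : ι → U → Prop) :
    ∃ (n : ℕ) (e : U → Finset.range n) (r' : ι → Finset.range n → Prop), n ≤ Nat.card (ι → Prop) ∧
      Function.Surjective e ∧ ∀ i u, r i u ↔ r' i (e u) := by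
  let g : U → Set.range (fun u i => r i u) := fun u => ⟨_, u, rfl⟩
  let d : Set.range (fun u i => r i u) ≃ Finset.range (Nat.card (Set.range (fun u i => r i u))) :=
    Classical.choice (Finite.card_eq.1 (card_range _).symm)
  refine ⟨_, d ∘ g, fun i c => (d.symm c).1 i, Finite.card_subtype_le _, ?_, ?_⟩
  · exact d.surjective.comp (by rintro ⟨_, u, rfl⟩; exact ⟨u, rfl⟩)
  · intro i u
    simp only [g, Function.comp, Equiv.symm_apply_apply]

/-! ### Chains of co-bijective relations -/

/-- A sequence of relations between consecutive levels. -/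
abbrev Bonds : Type := ∀ i, level i → level (i + 1) → Prop

/-- The relation on the union of the levels made of the bonds. -/
def Bonds.step (g : Bonds) (p q : Levels) : Prop :=
  ∃ i x y, p = ⟨i, x⟩ ∧ q = ⟨i + 1, y⟩ ∧ g i x y

/-- The order generated by the bonds. -/
def Bonds.ge (g : Bonds) : Levels → Levels → Prop := ReflTransGen g.step

/-- The part of a relation on the union of the levels between the levels `i` and `j`. -/
def link (ge : Levels → Levels → Prop) (i j : ℕ) (x : level i) (y : level j) : Prop :=
  ge ⟨i, x⟩ ⟨j, y⟩

theorem step_iff_of_bonds (ge : Levels → Levels → Prop) (p q : Levels) :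
    Bonds.step (fun i => link ge i (i + 1)) p q ↔ q.1 = p.1 + 1 ∧ ge p q := by
  constructor
  · rintro ⟨i, x, y, rfl, rfl, h⟩
    exact ⟨rfl, h⟩
  · obtain ⟨i, x⟩ := p
    obtain ⟨j, y⟩ := q
    rintro ⟨h, h'⟩
    dsimp only at h
    subst h
    exact ⟨i, x, y, rfl, rfl, h'⟩

/-- A chain order is generated by its bonds. -/
theorem IsChainOrder.eq_ge {ge : Levels → Levels → Prop} (h : IsChainOrder ge) :
    ge = Bonds.ge (fun i => link ge i (i + 1)) := by
  funext p q
  refine propext ((h.1 p q).trans ?_)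
  rw [Bonds.ge,
    show Bonds.step (fun i => link ge i (i + 1)) = fun s t => t.1 = s.1 + 1 ∧ ge s t from
    funext fun s => funext fun t => propext (step_iff_of_bonds ge s t)]

theorem Bonds.level_le {g : Bonds} {p q : Levels} (h : g.ge p q) : p.1 ≤ q.1 := by
  induction h with
  | refl => exact le_rfl
  | tail _ h ih =>
    obtain ⟨i, x, y, rfl, rfl, -⟩ := h
    exact ih.trans (Nat.le_succ _)

theorem Bonds.link_self (g : Bonds) (i : ℕ) : link g.ge i i = Eq := by
  funext x y
  refine propext ⟨fun h => ?_, ?_⟩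
  · rcases ReflTransGen.cases_tail h with h | ⟨q, h1, i', x', y', h2, h3, h4⟩
    · obtain rfl : y = x := by simpa using h
      rfl
    · have := Bonds.level_le h1
      subst h2
      have h5 := congrArg Sigma.fst h3
      dsimp only at this h5
      omega
  · rintro rfl
    exact ReflTransGen.refl

theorem Bonds.link_succ (g : Bonds) {i j : ℕ} (hij : i ≤ j) :
    link g.ge i (j + 1) = Comp (link g.ge i j) (g j) := by
  funext x z
  refine propext ⟨fun h => ?_, ?_⟩
  · rcases ReflTransGen.cases_tail h with h | ⟨q, h1, i', x', y', h2, h3, h4⟩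
    · have h5 := congrArg Sigma.fst h
      dsimp only at h5
      omega
    · have h5 := congrArg Sigma.fst h3
      dsimp only at h5
      obtain rfl : j = i' := by omega
      subst h2
      obtain rfl : z = y' := by simpa using h3
      exact ⟨x', h1, h4⟩
  · rintro ⟨y, h1, h2⟩
    exact ReflTransGen.tail h1 ⟨j, y, z, rfl, rfl, h2⟩

theorem Bonds.link_add_one (g : Bonds) (i : ℕ) : link g.ge i (i + 1) = g i := by
  rw [g.link_succ le_rfl, g.link_self, eq_comp]

theorem Bonds.link_comp (g : Bonds) {i j k : ℕ} (hij : i ≤ j) (hjk : j ≤ k) :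
    Comp (link g.ge i j) (link g.ge j k) = link g.ge i k := by
  induction k, hjk using Nat.le_induction with
  | base => rw [g.link_self, comp_eq]
  | succ k hjk ih => rw [g.link_succ hjk, g.link_succ (hij.trans hjk), ← ih, comp_assoc]

theorem Bonds.coBijective_link {g : Bonds} (hg : ∀ i, CoBijective (g i)) {i j : ℕ} (hij : i ≤ j) :
    CoBijective (link g.ge i j) := by
  induction j, hij using Nat.le_induction with
  | base => rw [g.link_self]; exact .eq
  | succ k hk ih => rw [g.link_succ hk]; exact ih.comp (hg k)

theorem Bonds.isChainOrder {g : Bonds} (hg : ∀ i, CoBijective (g i)) : IsChainOrder g.ge := by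
  refine ⟨fun p q => ?_, fun i => ?_⟩
  · have : (fun i => link g.ge i (i + 1)) = g := funext fun i => g.link_add_one i
    have h : g.step = fun s t => t.1 = s.1 + 1 ∧ g.ge s t := by
      conv_lhs => rw [← this]
      exact funext fun s => funext fun t => propext (step_iff_of_bonds g.ge s t)
    rw [← h]
    rfl
  · change CoBijective (link g.ge i (i + 1))
    rw [g.link_add_one]
    exact hg i

theorem Bonds.link_congr {g g' : Bonds} {i j : ℕ} (h : ∀ k, i ≤ k → k < j → g k = g' k) :
    link g.ge i j = link g'.ge i j := by
  rcases le_or_gt i j with hij | hij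
  · induction j, hij using Nat.le_induction with
    | base => rw [g.link_self, g'.link_self]
    | succ k hk ih =>
      rw [g.link_succ hk, g'.link_succ hk, ih fun l h1 h2 => h l h1 (h2.trans (Nat.lt_succ_self _)),
        h k hk (Nat.lt_succ_self _)]
  · funext x y
    refine propext ⟨fun h => ?_, fun h => ?_⟩ <;>
    · have := Bonds.level_le h
      dsimp only at this
      omega

theorem card_level (i : ℕ) : Nat.card (level i) = levelCard i :=
  card_range _

instance (i : ℕ) : Nonempty (level i) :=
  ⟨⟨0, Finset.mem_range.2 (by cases i <;> simp [levelCard])⟩⟩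

instance : Subsingleton (level 0) :=
  ⟨fun x y => Subtype.ext (by
    rw [Nat.lt_one_iff.1 (Finset.mem_range.1 x.2), Nat.lt_one_iff.1 (Finset.mem_range.1 y.2)])⟩

theorem levelCard_lt (i : ℕ) : levelCard i < levelCard (i + 1) := Nat.lt_two_pow_self

theorem levelCard_strictMono : StrictMono levelCard := strictMono_nat_of_lt_succ levelCard_lt

/-- A co-bijective relation between two different levels is a composition of bonds. -/
theorem Bonds.exists_link_eq (g : Bonds) (hg : ∀ i, CoBijective (g i)) {i j : ℕ} (hij : i < j)
    {r : level i → level j → Prop} (hr : CoBijective r) :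
    ∃ g' : Bonds, (∀ k, CoBijective (g' k)) ∧ (∀ k < i, g' k = g k) ∧ link g'.ge i j = r := by
  classical
  induction j, hij using Nat.le_induction with
  | base =>
    refine ⟨Function.update g i r, fun k => ?_, fun k hk => ?_, ?_⟩
    · rcases eq_or_ne k i with rfl | hk
      · simpa using hr
      · simpa [hk] using hg k
    · simp [hk.ne]
    · simp [Bonds.link_add_one]
  | succ j hj ih =>
    obtain ⟨s, t, hs, ht, rfl⟩ := hr.interpolate (Y := level j)
      (by simpa only [card_level] using levelCard_strictMono.monotone (Nat.le_of_succ_le hj))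
      (by simpa only [card_level] using (levelCard_lt j).le)
    obtain ⟨g', h1, h2, rfl⟩ := ih hs
    refine ⟨Function.update g' j t, fun k => ?_, fun k hk => ?_, ?_⟩
    · rcases eq_or_ne k j with rfl | hk
      · simpa using ht
      · simpa [hk] using h1 k
    · rw [Function.update_of_ne (by omega), h2 k hk]
    · rw [Bonds.link_succ _ (by omega), Function.update_self,
        Bonds.link_congr (g' := g') fun k _ hk => Function.update_of_ne hk.ne _ _]

/-! ### Constructing formulas -/

/-- Formulas that can be built from countably many by one application of a formation rule. -/
def formulaStep (S : Set (Σ X, Formula L X)) : Set (Σ X, Formula L X) :=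
  Set.range (fun X => ⟨X, .bot⟩) ∪
  Set.range (fun c : Σ (X : Finset ℕ) (R : Σ m, L.Relations m), Fin R.1 → X =>
    ⟨c.1, .rel c.2.1.2 c.2.2⟩) ∪
  (fun φ => ⟨φ.1, φ.2.neg⟩) '' S ∪
  {χ | ∃ φ ∈ S, ∃ ψ ∈ S, ∃ h : ψ.1 = φ.1, χ = ⟨φ.1, φ.2.and (h ▸ ψ.2)⟩} ∪
  ⋃ φ ∈ S, Set.range (fun c : Σ X : Finset ℕ, {r : X → φ.1 → Prop // CoBijective r} =>
    ⟨c.1, .ex c.2.1 c.2.2 φ.2⟩)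

theorem countable_formulaStep [Countable (Σ m, L.Relations m)] {S : Set (Σ X, Formula L X)}
    (hS : S.Countable) : (formulaStep S).Countable := by
  refine ((((Set.countable_range _).union (Set.countable_range _)).union (hS.image _)).union
    ?_).union (hS.biUnion fun φ _ => Set.countable_range _)
  refine ((hS.prod hS).biUnion (t := fun c _ => {χ | ∃ h : c.2.1 = c.1.1,
    χ = ⟨c.1.1, c.1.2.and (h ▸ c.2.2)⟩}) fun c _ => ?_).mono ?_
  · refine Set.Subsingleton.countable ?_
    rintro _ ⟨_, rfl⟩ _ ⟨_, rfl⟩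
    rfl
  · rintro χ ⟨φ, hφ, ψ, hψ, h⟩
    exact Set.mem_biUnion (x := (φ, ψ)) ⟨hφ, hψ⟩ h

theorem mem_iUnion_formulaStep {X : Finset ℕ} (φ : Formula L X) :
    ∃ n, (⟨X, φ⟩ : Σ X, Formula L X) ∈ formulaStep^[n] ∅ := by
  have mono : Monotone (formulaStep (L := L)) := by
    intro S S' h
    refine Set.union_subset_union (Set.union_subset_union (Set.union_subset_union_right _
      (Set.image_mono h)) ?_) (Set.biUnion_subset_biUnion_left h)
    rintro χ ⟨φ, hφ, ψ, hψ, h'⟩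
    exact ⟨φ, h hφ, ψ, h hψ, h'⟩
  have up : Monotone fun n => formulaStep (L := L)^[n] ∅ :=
    mono.monotone_iterate_of_le_map (Set.empty_subset _)
  induction φ with
  | bot => exact ⟨1, .inl (.inl (.inl (.inl ⟨_, rfl⟩)))⟩
  | rel R x => exact ⟨1, .inl (.inl (.inl (.inr ⟨⟨_, ⟨_, R⟩, x⟩, rfl⟩)))⟩
  | neg φ ih =>
    obtain ⟨n, hn⟩ := ih
    refine ⟨n + 1, ?_⟩
    rw [Function.iterate_succ_apply']
    exact .inl (.inl (.inr ⟨_, hn, rfl⟩))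
  | and φ ψ ih1 ih2 =>
    obtain ⟨n, hn⟩ := ih1
    obtain ⟨k, hk⟩ := ih2
    refine ⟨max n k + 1, ?_⟩
    rw [Function.iterate_succ_apply']
    exact .inl (.inr ⟨_, up (le_max_left _ _) hn, _, up (le_max_right _ _) hk, rfl, rfl⟩)
  | ex r hr φ ih =>
    obtain ⟨n, hn⟩ := ih
    refine ⟨n + 1, ?_⟩
    rw [Function.iterate_succ_apply']
    exact .inr (Set.mem_biUnion hn ⟨⟨_, r, hr⟩, rfl⟩)

theorem countable_formula [Countable (Σ m, L.Relations m)] (X : Finset ℕ) :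
    Countable (Formula L X) := by
  have h : (⋃ n, formulaStep (L := L)^[n] ∅).Countable := by
    refine Set.countable_iUnion fun n => ?_
    induction n with
    | zero => exact Set.countable_empty
    | succ n ih => rw [Function.iterate_succ_apply']; exact countable_formulaStep ih
  have : Countable (⋃ n, formulaStep (L := L)^[n] ∅) := h
  refine Function.Injective.countable (β := ⋃ n, formulaStep (L := L)^[n] ∅)
    (f := fun φ => ⟨⟨X, φ⟩, Set.mem_iUnion.2 (mem_iUnion_formulaStep φ)⟩) ?_
  intro φ ψ h
  simpa using h

/-- Finite disjunctions. -/
theorem exists_disj {X : Finset ℕ} {ι : Type*} [Finite ι] (φ : ι → Formula L X) :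
    ∃ ψ : Formula L X, ∀ (M : ProtoStructure.{uf, ur, u} L) (v : X → M.carrier → Prop),
      M.Sat ψ v ↔ ∃ i, M.Sat (φ i) v := by
  have key : ∀ s : Set ι, s.Finite → ∃ ψ : Formula L X, ∀ (M : ProtoStructure.{uf, ur, u} L)
      (v : X → M.carrier → Prop), M.Sat ψ v ↔ ∃ i ∈ s, M.Sat (φ i) v := by
    intro s hs
    induction s, hs using Set.Finite.induction_on with
    | empty => exact ⟨.bot, fun M v => by simp [ProtoStructure.Sat]⟩
    | @insert i _ _ _ ih =>
      obtain ⟨ψ, hψ⟩ := ih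
      refine ⟨.neg (.and (.neg ψ) (.neg (φ i))), fun M v => ?_⟩
      simp only [ProtoStructure.Sat, hψ]
      rw [Set.exists_mem_insert, not_and_or, not_not, not_not, or_comm]
  obtain ⟨ψ, hψ⟩ := key _ Set.finite_univ
  exact ⟨ψ, fun M v => by simpa using hψ M v⟩

/-- Admissible co-valuations have a common fragmentation in a context of bounded size. -/
theorem ProtoStructure.IsStructure.exists_bounded_fragmentation
    {M : ProtoStructure.{uf, ur, u} L} (hM : M.IsStructure) {X Y : Finset ℕ}
    {v : X → M.carrier → Prop} {w : Y → M.carrier → Prop} (hv : v ∈ M.V X) (hw : w ∈ M.V Y) :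
    ∃ n ≤ Nat.card (X ⊕ Y → Prop), ∃ (a : X → Finset.range n → Prop)
      (b : Y → Finset.range n → Prop), CoBijective a ∧ CoBijective b ∧
      ∃ z ∈ M.V (Finset.range n), v = Comp a z ∧ w = Comp b z := by
  obtain ⟨Z, z, hz, ⟨a, ha, rfl⟩, ⟨b, hb, rfl⟩⟩ := hM.directed v hv w hw
  obtain ⟨n, e, r, hn, he, hr⟩ := exists_grouping (Sum.elim a b)
  have hz' := M.closed _ (CoBijective.fibre he) hz
  have h1 : Comp a z = Comp (fun x => r (.inl x)) (Comp (fun c u => e u = c) z) := by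
    rw [← comp_assoc]
    congr 1
    funext x u
    exact propext ((hr (.inl x) u).trans ⟨fun h => ⟨_, h, rfl⟩, by rintro ⟨_, h, rfl⟩; exact h⟩)
  have h2 : Comp b z = Comp (fun x => r (.inr x)) (Comp (fun c u => e u = c) z) := by
    rw [← comp_assoc]
    congr 1
    funext x u
    exact propext ((hr (.inr x) u).trans ⟨fun h => ⟨_, h, rfl⟩, by rintro ⟨_, h, rfl⟩; exact h⟩)
  refine ⟨n, hn, _, _, ?_, ?_, _, hz', h1, h2⟩
  · exact (M.coval hz').of_comp (h1 ▸ M.coval hv)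
  · exact (M.coval hz').of_comp (h2 ▸ M.coval hw)

theorem finite_patterns (X Y : Finset ℕ) (N : ℕ)
    (P : ∀ n, (X → Finset.range n → Prop) → (Y → Finset.range n → Prop) → Prop) :
    Finite {c : Σ n, (X → Finset.range n → Prop) × (Y → Finset.range n → Prop) //
      c.1 ≤ N ∧ P c.1 c.2.1 c.2.2} := by
  refine Finite.of_injective (β := Σ n : Fin (N + 1),
    (X → Finset.range n → Prop) × (Y → Finset.range n → Prop))
    (fun c => ⟨⟨c.1.1, Nat.lt_succ_of_le c.2.1⟩, c.1.2⟩) ?_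
  rintro ⟨⟨n, c⟩, h⟩ ⟨⟨m, d⟩, h'⟩ heq
  simp only [Sigma.mk.injEq, Fin.mk.injEq] at heq
  obtain ⟨rfl, h2⟩ := heq
  obtain rfl := eq_of_heq h2
  rfl

/-- Satisfaction at a consolidation of `v` is expressed by a formula at `v`. The quantifier is
handled by ranging over the finitely many patterns in which a fragmentation of the consolidation
and `v` can have a common fragmentation of bounded size. -/
theorem exists_subst {Y : Finset ℕ} (φ : Formula L Y) :
    ∀ {X : Finset ℕ} (r : Y → X → Prop), CoBijective r → ∃ ψ : Formula L X,
      ∀ M : ProtoStructure.{uf, ur, u} L, M.IsStructure → ∀ v ∈ M.V X,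
        (M.Sat ψ v ↔ M.Sat φ (Comp r v)) := by
  induction φ with
  | bot => exact fun r hr => ⟨.bot, fun M hM v hv => Iff.rfl⟩
  | rel R x =>
    intro X r hr
    obtain ⟨ψ, hψ⟩ := exists_disj.{uf, ur, u} (ι := {y : _ → X // ∀ k, r (x k) (y k)})
      fun y => Formula.rel R y.1
    refine ⟨ψ, fun M hM v hv => (hψ M v).trans ?_⟩
    simp only [ProtoStructure.Sat, Comp]
    constructor
    · rintro ⟨⟨y, hy⟩, a, h1, h2⟩
      exact ⟨a, fun k => ⟨y k, hy k, h1 k⟩, h2⟩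
    · rintro ⟨a, h1, h2⟩
      choose y hy using h1
      exact ⟨⟨y, fun k => (hy k).1⟩, a, fun k => (hy k).2, h2⟩
  | neg φ ih =>
    intro X r hr
    obtain ⟨ψ, hψ⟩ := ih r hr
    exact ⟨ψ.neg, fun M hM v hv => not_congr (hψ M hM v hv)⟩
  | and φ φ' ih ih' =>
    intro X r hr
    obtain ⟨ψ, hψ⟩ := ih r hr
    obtain ⟨ψ', hψ'⟩ := ih' r hr
    exact ⟨ψ.and ψ', fun M hM v hv => and_congr (hψ M hM v hv) (hψ' M hM v hv)⟩
  | @ex Y Z s hs φ ih =>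
    intro X r hr
    have := finite_patterns X Z (Nat.card (X ⊕ Z → Prop)) fun n a b =>
      CoBijective a ∧ CoBijective b ∧ Comp r a = Comp s b
    choose ψ' hψ' using fun (n : ℕ) (b : Z → Finset.range n → Prop) (hb : CoBijective b) => ih b hb
    obtain ⟨ψ, hψ⟩ := exists_disj.{uf, ur, u} fun c : {c : Σ n, (X → Finset.range n → Prop) ×
      (Z → Finset.range n → Prop) // c.1 ≤ Nat.card (X ⊕ Z → Prop) ∧
        CoBijective c.2.1 ∧ CoBijective c.2.2 ∧ Comp r c.2.1 = Comp s c.2.2} =>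
      Formula.ex c.1.2.1 c.2.2.1 (ψ' c.1.1 c.1.2.2 c.2.2.2.1)
    refine ⟨ψ, fun M hM v hv => (hψ M v).trans ?_⟩
    simp only [ProtoStructure.Sat]
    constructor
    · rintro ⟨⟨⟨n, a, b⟩, h1, h2, h3, h4⟩, z, hz, rfl, h⟩
      refine ⟨Comp b z, M.closed b h3 hz, ?_, (hψ' n b h3 M hM z hz).1 h⟩
      exact comp_assoc.symm.trans ((congrArg (Comp · z) h4).trans comp_assoc)
    · rintro ⟨w, hw, h1, h2⟩
      obtain ⟨n, hn, a, b, ha, hb, z, hz, rfl, rfl⟩ := hM.exists_bounded_fragmentation hv hw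
      refine ⟨⟨⟨n, a, b⟩, hn, ha, hb, comp_right_cancel (M.coval hz) ?_⟩, z, hz, rfl,
        (hψ' n b hb M hM z hz).2 h2⟩
      rw [comp_assoc, comp_assoc, h1]

/-- The tuple `y` is privately related by `R`, seen from `w`: in every fragmentation of `w` there is
a tuple satisfying `R` whose entries lie below no elements of the context of `w` but those of `y`.
This is the trace that a tuple of `R` consisting of private points of the `[y_k]_w` leaves on
admissible co-valuations. -/
def ProtoStructure.PrivatelyRelated (M : ProtoStructure.{uf, ur, u} L) {m : ℕ} (R : L.Relations m)
    {Y : Finset ℕ} (y : Fin m → Y) (w : Y → M.carrier → Prop) : Prop :=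
  ∀ (U : Finset ℕ) (u : U → M.carrier → Prop) (r : Y → U → Prop), u ∈ M.V U → CoBijective r →
    w = Comp r u → ∃ z : Fin m → U, (∀ k, Priv r (y k) (z k)) ∧ M.Sat (.rel R z) u

theorem ProtoStructure.privatelyRelated_of_priv (M : ProtoStructure.{uf, ur, u} L) {m : ℕ}
    {R : L.Relations m} {Y : Finset ℕ} {y : Fin m → Y} {w : Y → M.carrier → Prop}
    {a : Fin m → M.carrier} (hp : ∀ k, Priv w (y k) (a k)) (hR : M.Holds R a) :
    M.PrivatelyRelated R y w := by
  rintro U u r hu hr rfl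
  choose z hz using fun k => (M.coval hu).cosurj (a k)
  refine ⟨z, fun k => ?_, a, hz, hR⟩
  have h : ∀ y', r y' (z k) → y' = y k := fun y' h => (hp k).2 y' ⟨_, h, hz k⟩
  obtain ⟨y', hy'⟩ := hr.cosurj (z k)
  exact ⟨h y' hy' ▸ hy', h⟩

/-- Being privately related is expressible, again because it is enough to consider fragmentations
in contexts of bounded size. -/
theorem exists_privatelyRelated_formula {m : ℕ} (R : L.Relations m) {Y : Finset ℕ}
    (y : Fin m → Y) : ∃ ψ : Formula L Y, ∀ (M : ProtoStructure.{uf, ur, u} L),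
      ∀ w : Y → M.carrier → Prop, M.Sat ψ w ↔ M.PrivatelyRelated R y w := by
  have := finite_patterns Y ∅ (Nat.card (Y → Prop)) fun n a _ => CoBijective a
  choose ρ hρ using fun (n : ℕ) (a : Y → Finset.range n → Prop) =>
    exists_disj.{uf, ur, u} (ι := {z : Fin m → Finset.range n // ∀ k, Priv a (y k) (z k)})
      fun z => Formula.rel R z.1
  obtain ⟨ψ, hψ⟩ := exists_disj.{uf, ur, u} fun c : {c : Σ n, (Y → Finset.range n → Prop) ×
      ((∅ : Finset ℕ) → Finset.range n → Prop) // c.1 ≤ Nat.card (Y → Prop) ∧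
        CoBijective c.2.1} => Formula.ex c.1.2.1 c.2.2 (ρ c.1.1 c.1.2.1).neg
  refine ⟨ψ.neg, fun M w => ?_⟩
  simp only [ProtoStructure.Sat, hψ, hρ, not_exists, not_and, not_forall, not_not]
  constructor
  · rintro h U u r hu hr rfl
    obtain ⟨n, e, r', hn, he, hr'⟩ := exists_grouping r
    have hcomp : r = Comp r' (fun c u => e u = c) := by
      funext x u
      exact propext ((hr' x u).trans ⟨fun h => ⟨_, h, rfl⟩, by rintro ⟨_, h, rfl⟩; exact h⟩)
    have hcb : CoBijective r' := (CoBijective.fibre he).of_comp (hcomp ▸ hr)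
    obtain ⟨⟨z, hz⟩, a, ha, hR⟩ := h ⟨⟨n, r', fun _ _ => False⟩, hn, hcb⟩ _
      (M.closed _ (.fibre he) hu) (by rw [← comp_assoc, ← hcomp])
    choose t ht using ha
    refine ⟨t, fun k => ?_, a, fun k => (ht k).2, hR⟩
    have this : Priv r' (y k) (z k) := hz k
    rw [show z k = e (t k) from (ht k).1.symm] at this
    exact ⟨(hr' _ _).2 this.1, fun y' h => this.2 y' ((hr' _ _).1 h)⟩
  · rintro h ⟨⟨n, a, _⟩, hn, ha⟩ u hu rfl
    obtain ⟨z, hz, b, hb⟩ := h _ u a hu ha rfl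
    exact ⟨⟨z, hz⟩, b, hb.1, hb.2⟩

/-- The formula in the context of `w` that says that `y` is privately related by `R`. -/
noncomputable def privateFormula {m : ℕ} (R : L.Relations m) {Y : Finset ℕ} (y : Fin m → Y) :
    Formula L Y :=
  (exists_privatelyRelated_formula.{uf, ur, u} R y).choose

theorem ProtoStructure.sat_privateFormula (M : ProtoStructure.{uf, ur, u} L) {m : ℕ}
    (R : L.Relations m) {Y : Finset ℕ} (y : Fin m → Y) (w : Y → M.carrier → Prop) :
    M.Sat (privateFormula.{uf, ur, u} R y) w ↔ M.PrivatelyRelated R y w :=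
  (exists_privatelyRelated_formula.{uf, ur, u} R y).choose_spec M w

/-! ### Change of universe -/

/-- A copy of `M` in another universe. -/
def ProtoStructure.lift (M : ProtoStructure.{uf, ur, 0} L) : ProtoStructure.{uf, ur, u} L where
  carrier := ULift.{u} M.carrier
  str := { funMap := fun f a => ⟨M.str.funMap f fun k => (a k).down⟩
           RelMap := fun R a => M.str.RelMap R fun k => (a k).down }
  V X := {v | (fun x a => v x ⟨a⟩) ∈ M.V X}
  coval {X v} h := by
    refine ⟨fun x => ?_, fun ⟨a⟩ => (M.coval h).cosurj a⟩
    obtain ⟨a, ha⟩ := (M.coval h).coinj x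
    exact ⟨⟨a⟩, ha⟩
  closed r _ hr hw := M.closed r hr hw

theorem ProtoStructure.sat_lift (M : ProtoStructure.{uf, ur, 0} L) {X : Finset ℕ}
    (φ : Formula L X) (v : X → M.carrier → Prop) :
    (M.lift : ProtoStructure.{uf, ur, u} L).Sat φ (fun x a => v x a.down) ↔ M.Sat φ v := by
  induction φ with
  | bot => exact Iff.rfl
  | rel R x =>
    constructor
    · rintro ⟨a, h⟩
      exact ⟨fun k => (a k).down, h⟩
    · rintro ⟨a, h⟩
      exact ⟨fun k => ⟨a k⟩, h⟩
  | neg φ ih => exact not_congr (ih v)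
  | and φ ψ ih1 ih2 => exact and_congr (ih1 v) (ih2 v)
  | ex r hr φ ih =>
    constructor
    · rintro ⟨w, hw, h, h'⟩
      exact ⟨fun y a => w y ⟨a⟩, hw, funext₂ fun x a => congrFun₂ h x ⟨a⟩,
        (ih fun y a => w y ⟨a⟩).1 h'⟩
    · rintro ⟨w, hw, rfl, h⟩
      exact ⟨fun y a => w y a.down, hw, rfl, (ih w).2 h⟩

theorem ProtoStructure.IsStructure.lift {M : ProtoStructure.{uf, ur, 0} L} (h : M.IsStructure) :
    (M.lift : ProtoStructure.{uf, ur, u} L).IsStructure where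
  nonempty := h.nonempty.map ULift.up
  admissible_nonempty := by
    obtain ⟨X, v, hv⟩ := h.admissible_nonempty
    exact ⟨X, fun x a => v x a.down, hv⟩
  directed := by
    intro X Y v hv w hw
    obtain ⟨Z, z, hz, ⟨r, hr, h1⟩, ⟨s, hs, h2⟩⟩ := h.directed _ hv _ hw
    exact ⟨Z, fun x a => z x a.down, hz, ⟨r, hr, funext₂ fun x a => congrFun₂ h1 x a.down⟩,
      ⟨s, hs, funext₂ fun x a => congrFun₂ h2 x a.down⟩⟩
  witness := by
    intro m R X v hv x hx
    obtain ⟨Y, w, y, a, hw, h1, h2, h3⟩ := h.witness R (fun x a => v x ⟨a⟩) hv x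
      ((M.sat_lift (.rel R x) fun x a => v x ⟨a⟩).1 hx)
    exact ⟨Y, fun x a => w x a.down, y, fun k => ⟨a k⟩, hw, h1, fun k b => h2 k b.down, h3⟩

theorem ProtoStructure.IsModel.lift {M : ProtoStructure.{uf, ur, 0} L}
    {T : Set (Formula L starCtx)} (h : M.IsModel T) :
    (M.lift : ProtoStructure.{uf, ur, u} L).IsModel T := by
  obtain ⟨h1, v, hv, h2⟩ := h
  exact ⟨h1.lift, fun x a => v x a.down, hv, fun φ hφ => (M.sat_lift φ v).2 (h2 φ hφ)⟩

theorem ProtoStructure.IsCompactOmegaModel.lift {M : ProtoStructure.{uf, ur, 0} L}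
    {T : Set (Formula L starCtx)} (h : M.IsCompactOmegaModel T) :
    (M.lift : ProtoStructure.{uf, ur, u} L).IsCompactOmegaModel T := by
  obtain ⟨h0, ⟨τ, h1, h2, h3, h4, h5⟩, ⟨C, v, h6, h7, h8⟩⟩ := h
  refine ⟨h0.lift, ⟨inferInstanceAs (TopologicalSpace (ULift.{u} M.carrier)),
    inferInstanceAs (CompactSpace (ULift.{u} M.carrier)),
    inferInstanceAs (T1Space (ULift.{u} M.carrier)), ?_, ?_, ?_⟩,
    C, fun i x a => v i x a.down, h6, fun i => ?_, fun X u hu => ?_⟩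
  · intro X w hw x
    exact (h3 X _ hw x).preimage continuous_uliftDown
  · intro 𝒰 h𝒰 hcov
    obtain ⟨X, w, hw, h⟩ := h4 ((fun U => ULift.up ⁻¹' U) '' 𝒰)
      (by rintro _ ⟨U, hU, rfl⟩; exact (h𝒰 U hU).preimage continuous_uliftUp)
      (Set.eq_univ_of_forall fun a => by
        obtain ⟨U, hU, ha⟩ := Set.eq_univ_iff_forall.1 hcov ⟨a⟩
        exact ⟨_, ⟨U, hU, rfl⟩, ha⟩)
    refine ⟨X, fun x a => w x a.down, hw, fun x => ?_⟩
    obtain ⟨_, ⟨U, hU, rfl⟩, hU'⟩ := h x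
    exact ⟨U, hU, fun a ha => hU' (show a.down ∈ {a | w x a} from ha)⟩
  · intro m R
    refine (h5 R).preimage (f := fun (a : Fin m → ULift.{u} M.carrier) k => (a k).down) ?_
    exact continuous_pi fun k => continuous_uliftDown.comp (continuous_apply k)
  · obtain ⟨r, hr, h⟩ := h7 i
    exact ⟨r, hr, funext₂ fun x a => congrFun₂ h x a.down⟩
  · obtain ⟨i, r, hr, h⟩ := h8 X _ hu
    exact ⟨i, r, hr, funext₂ fun x a => congrFun₂ h x a.down⟩

/-! ### Structures with a finest admissible co-valuation -/

/-- The structure on the context of an admissible co-valuation `v` of `M` whose relations are the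
atomic formulas true at `v` and whose admissible co-valuations are the consolidation patterns. -/
def ProtoStructure.onContext [L.IsRelational] (M : ProtoStructure.{uf, ur, u} L) {X : Finset ℕ}
    (v : X → M.carrier → Prop) : ProtoStructure.{uf, ur, u} L where
  carrier := ULift.{u} X
  str := { RelMap := fun R a => M.Sat (.rel R fun k => (a k).down) v }
  V Y := {s | CoBijective s}
  coval h := h
  closed _ _ hr hw := hr.comp hw

/-- If `v` is finest in `M`, then the structure on its context has the same theory as `M`. -/
theorem ProtoStructure.sat_onContext [L.IsRelational] (M : ProtoStructure.{uf, ur, u} L)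
    {X : Finset ℕ} {v : X → M.carrier → Prop} (hv : v ∈ M.V X)
    (hfin : ∀ Y, ∀ w ∈ M.V Y, Consolidates w v) {Y : Finset ℕ} (φ : Formula L Y) :
    ∀ s : Y → ULift.{u} X → Prop, CoBijective s →
      ((M.onContext v).Sat φ s ↔ M.Sat φ (Comp (fun y x => s y ⟨x⟩) v)) := by
  induction φ with
  | bot => exact fun s hs => Iff.rfl
  | rel R x =>
    intro s hs
    constructor
    · rintro ⟨a, h1, b, h2, h3⟩
      exact ⟨b, fun k => ⟨(a k).down, h1 k, h2 k⟩, h3⟩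
    · rintro ⟨b, h1, h2⟩
      choose a ha using h1
      exact ⟨fun k => ⟨a k⟩, fun k => (ha k).1, b, fun k => (ha k).2, h2⟩
  | neg φ ih => exact fun s hs => not_congr (ih s hs)
  | and φ ψ ih1 ih2 => exact fun s hs => and_congr (ih1 s hs) (ih2 s hs)
  | ex r hr φ ih =>
    intro s hs
    constructor
    · rintro ⟨w, hw, rfl, h⟩
      refine ⟨Comp (fun y x => w y ⟨x⟩) v, M.closed _ ?_ hv, ?_, (ih w hw).1 h⟩
      · exact ⟨fun y => let ⟨a, ha⟩ := (hw : CoBijective w).coinj y; ⟨a.down, ha⟩,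
          fun x => (hw : CoBijective w).cosurj ⟨x⟩⟩
      · exact comp_assoc (r := r) (p := fun y x => w y ⟨x⟩)
    · rintro ⟨w, hw, h1, h2⟩
      obtain ⟨t, ht, rfl⟩ := hfin _ w hw
      have ht' : CoBijective fun y (a : ULift.{u} X) => t y a.down :=
        ⟨fun y => let ⟨a, ha⟩ := ht.coinj y; ⟨⟨a⟩, ha⟩, fun x => ht.cosurj x.down⟩
      refine ⟨_, ht', ?_, (ih _ ht').2 h2⟩
      have := comp_right_cancel (M.coval hv) (h1.trans comp_assoc.symm)
      exact funext₂ fun y x => congrFun₂ this y x.down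

theorem ProtoStructure.onContext_isCompactOmegaModel [L.IsRelational]
    {M : ProtoStructure.{uf, ur, u} L} {T : Set (Formula L starCtx)} (hM : M.IsModel T)
    {X : Finset ℕ} {v : X → M.carrier → Prop} (hv : v ∈ M.V X)
    (hfin : ∀ Y, ∀ w ∈ M.V Y, Consolidates w v) : (M.onContext v).IsCompactOmegaModel T := by
  have hid : CoBijective fun (x : X) (a : ULift.{u} X) => x = a.down :=
    ⟨fun x => ⟨⟨x⟩, rfl, fun _ h => h⟩, fun x => ⟨x.down, rfl⟩⟩
  have hall : ∀ {Y : Finset ℕ} (s : Y → ULift.{u} X → Prop), CoBijective s →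
      Consolidates s fun (x : X) (a : ULift.{u} X) => x = a.down := by
    intro Y s hs
    refine ⟨fun y x => s y ⟨x⟩, ⟨fun y => let ⟨a, ha⟩ := hs.coinj y; ⟨a.down, ha⟩,
      fun x => hs.cosurj ⟨x⟩⟩, ?_⟩
    exact (comp_eq_fun (r := fun y x => s y ⟨x⟩) ULift.down).symm
  obtain ⟨hs, v₀, hv₀, hT⟩ := hM
  refine ⟨⟨⟨?_, ⟨X, _, hid⟩, ?_, ?_⟩, ?_⟩, ?_, ?_⟩
  · obtain ⟨a⟩ := hs.nonempty
    obtain ⟨x, -⟩ := (M.coval hv).cosurj a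
    exact ⟨⟨x⟩⟩
  · exact fun s hs t ht => ⟨X, _, hid, hall s hs, hall t ht⟩
  · rintro m R Y s hs x ⟨a, h1, h2⟩
    refine ⟨X, _, fun k => (a k).down, a, hid, fun k => ⟨rfl, fun _ h => h⟩, ?_, h2⟩
    intro k b hb
    obtain rfl : a k = b := ULift.ext _ _ hb
    exact h1 k
  · obtain ⟨t, ht, rfl⟩ := hfin _ v₀ hv₀
    have ht' : CoBijective fun y (a : ULift.{u} X) => t y a.down :=
      ⟨fun y => let ⟨a, ha⟩ := ht.coinj y; ⟨⟨a⟩, ha⟩, fun x => ht.cosurj x.down⟩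
    exact ⟨_, ht', fun φ hφ => (M.sat_onContext hv hfin φ _ ht').2 (hT φ hφ)⟩
  · let : TopologicalSpace (ULift.{u} X) := ⊥
    have : DiscreteTopology (ULift.{u} X) := ⟨rfl⟩
    refine ⟨inferInstanceAs (TopologicalSpace (ULift.{u} X)),
      inferInstanceAs (CompactSpace (ULift.{u} X)), inferInstanceAs (T1Space (ULift.{u} X)),
      fun _ _ _ _ => isOpen_discrete (α := ULift.{u} X) _, ?_,
      fun R => isClosed_discrete (α := Fin _ → ULift.{u} X) _⟩
    intro 𝒰 _ hcov
    refine ⟨X, _, hid, fun x => ?_⟩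
    obtain ⟨U, hU, hx⟩ := Set.eq_univ_iff_forall.1 hcov ⟨x⟩
    refine ⟨U, hU, fun a ha => ?_⟩
    obtain rfl : ⟨x⟩ = a := ULift.ext _ _ ha
    exact hx
  · exact ⟨fun _ => X, fun _ => _, fun _ => hid, fun _ => ⟨Eq, .eq, eq_comp.symm⟩,
      fun Y s hs => ⟨0, hall s hs⟩⟩

/-- If all compact `ω`-models of `T` are infinite, then the admissible co-valuations of a model of
`T` have unbounded size: one of maximal size would be finest, and its context would carry a finite
compact `ω`-model. -/
theorem exists_large_coval [L.IsRelational] {T : Set (Formula L starCtx)}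
    (hinf : ∀ M : ProtoStructure.{uf, ur, u} L, M.IsCompactOmegaModel T → Infinite M.carrier)
    {M : ProtoStructure.{uf, ur, u} L} (hM : M.IsModel T) (n : ℕ) :
    ∃ X : Finset ℕ, n ≤ X.card ∧ (M.V X).Nonempty := by
  by_contra! hn
  have hex : ∃ N, ∃ X : Finset ℕ, X.card + N = n ∧ (M.V X).Nonempty := by
    obtain ⟨X, hX⟩ := hM.1.admissible_nonempty
    refine ⟨n - X.card, X, ?_, hX⟩
    by_contra h
    exact hX.ne_empty (hn X (by omega))
  classical
  obtain ⟨X, hX, v, hv⟩ := Nat.find_spec hex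
  have hmax : ∀ Z : Finset ℕ, (M.V Z).Nonempty → Z.card ≤ X.card := by
    intro Z hZ
    by_contra! hlt
    have : Z.card < n := by
      by_contra! h
      exact hZ.ne_empty (hn Z h)
    exact Nat.find_min hex (m := n - Z.card) (by omega) ⟨Z, by omega, hZ⟩
  have hfin : ∀ Y, ∀ w ∈ M.V Y, Consolidates w v := by
    intro Y w hw
    obtain ⟨Z, z, hz, ⟨r, hr, rfl⟩, ⟨s, hs, rfl⟩⟩ := hM.1.directed v hv w hw
    obtain ⟨t, ht, h⟩ := hr.exists_inverse (by simpa using hmax Z ⟨z, hz⟩)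
    exact ⟨Comp s t, hs.comp ht, by rw [comp_assoc, ← comp_assoc (r := t), h, eq_comp]⟩
  have : Infinite (ULift.{u} X) := hinf _ (M.onContext_isCompactOmegaModel hM hv hfin)
  exact not_finite (ULift.{u} X)

/-! ### The spectrum of a chain order -/

namespace IsChainOrder

variable {ge : Levels → Levels → Prop}

theorem refl (h : IsChainOrder ge) (p : Levels) : ge p p := by
  rw [h.eq_ge]
  exact ReflTransGen.refl

theorem trans (h : IsChainOrder ge) {p q r : Levels} (h1 : ge p q) (h2 : ge q r) : ge p r := by
  rw [h.eq_ge] at *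
  exact ReflTransGen.trans h1 h2

theorem level_le (h : IsChainOrder ge) {p q : Levels} (h1 : ge p q) : p.1 ≤ q.1 := by
  rw [h.eq_ge] at h1
  exact Bonds.level_le h1

theorem link_comp (h : IsChainOrder ge) {i j k : ℕ} (hij : i ≤ j) (hjk : j ≤ k) :
    Comp (link ge i j) (link ge j k) = link ge i k := by
  rw [h.eq_ge]
  exact Bonds.link_comp _ hij hjk

theorem coBijective_link (h : IsChainOrder ge) {i j : ℕ} (hij : i ≤ j) :
    CoBijective (link ge i j) := by
  rw [h.eq_ge]
  exact Bonds.coBijective_link h.2 hij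

theorem isBand_level (h : IsChainOrder ge) (i : ℕ) :
    IsBand ge (Set.range fun x : level i => (⟨i, x⟩ : Levels)) := by
  refine ⟨Set.finite_range _, ?_⟩
  rintro ⟨j, y⟩
  rcases le_total j i with hji | hij
  · obtain ⟨x, hx⟩ := (h.coBijective_link hji).coinj y
    exact ⟨_, ⟨x, rfl⟩, .inl hx.1⟩
  · obtain ⟨x, hx⟩ := (h.coBijective_link hij).cosurj y
    exact ⟨_, ⟨x, rfl⟩, .inr hx⟩

theorem exists_level_of_isCap (h : IsChainOrder ge) {C : Set Levels} (hC : IsCap ge C) :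
    ∃ i, ∀ j, i ≤ j → ∀ x : level j, ∃ c ∈ C, ge c ⟨j, x⟩ := by
  obtain ⟨B, ⟨hBf, hB⟩, hBC⟩ := hC
  obtain ⟨N, hN⟩ := (hBf.image Sigma.fst).bddAbove
  refine ⟨N + 1, fun j hj x => ?_⟩
  obtain ⟨b, hb, hbx⟩ := hB ⟨j, x⟩
  obtain ⟨c, hc, hcb⟩ := hBC b hb
  have hbN : b.1 ≤ N := hN ⟨b, hb, rfl⟩
  have hge : ge b ⟨j, x⟩ := by
    rcases hbx with hbx | hbx
    · have := h.level_le hbx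
      dsimp only at this
      omega
    · exact hbx
  exact ⟨c, hc, h.trans hcb hge⟩

theorem exists_mem_level (h : IsChainOrder ge) {S : Set Levels} (hS : IsSelector ge S) (i : ℕ) :
    ∃ x : level i, ⟨i, x⟩ ∈ S := by
  obtain ⟨_, hp, x, rfl⟩ := hS _ ⟨_, h.isBand_level i, fun b hb => ⟨b, hb, h.refl b⟩⟩
  exact ⟨x, hp⟩

/-- An upset that meets every level is a selector. -/
theorem isSelector_of_upset (h : IsChainOrder ge) {S : Set Levels}
    (hup : ∀ p q, ge p q → q ∈ S → p ∈ S) (hlev : ∀ i, ∃ x : level i, ⟨i, x⟩ ∈ S) :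
    IsSelector ge S := by
  intro C hC
  obtain ⟨i, hi⟩ := h.exists_level_of_isCap hC
  obtain ⟨x, hx⟩ := hlev i
  obtain ⟨c, hc, hcx⟩ := hi i le_rfl x
  exact ⟨c, hup _ _ hcx hx, hc⟩

/-- Selectors contain minimal selectors, as it is enough for a selector to meet the finite caps. -/
theorem exists_minimal_selector {S : Set Levels} (hS : IsSelector ge S) :
    ∃ S' ⊆ S, Minimal (IsSelector ge) S' := by
  refine zorn_superset_nonempty {S | IsSelector ge S} (fun c hc hchain hne => ?_) S hS
  refine ⟨⋂₀ c, ?_, fun s hs => Set.sInter_subset_of_mem hs⟩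
  intro C hC
  obtain ⟨B, hB, hBC⟩ := hC
  choose! f hf using hBC
  have hfin : (f '' B).Finite := hB.1.image f
  have hcap : IsCap ge (f '' B) := ⟨B, hB, fun b hb => ⟨f b, ⟨b, hb, rfl⟩, (hf b hb).2⟩⟩
  by_contra hcon
  -- A member of the chain that avoids all elements of the finite cap `f '' B`.
  have key : ∀ F : Set Levels, F.Finite → F ⊆ f '' B → ∃ s ∈ c, s ∩ F = ∅ := by
    intro F hF
    induction F, hF using Set.Finite.induction_on with
    | empty => exact fun _ => ⟨_, hne.some_mem, Set.inter_empty _⟩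
    | @insert a F _ _ ih =>
      intro haF
      obtain ⟨s, hs, hsF⟩ := ih ((Set.subset_insert _ _).trans haF)
      obtain ⟨b, hb, rfl⟩ := haF (Set.mem_insert _ _)
      obtain ⟨s', hs', hbs'⟩ : ∃ s' ∈ c, f b ∉ s' := by
        by_contra! hall
        exact hcon ⟨f b, hall, (hf b hb).1⟩
      rcases hchain.total hs hs' with hss | hss
      · refine ⟨s, hs, Set.eq_empty_of_forall_notMem ?_⟩
        rintro x ⟨hx, rfl | hxF⟩
        · exact hbs' (hss hx)
        · exact (Set.eq_empty_iff_forall_notMem.1 hsF x) ⟨hx, hxF⟩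
      · refine ⟨s', hs', Set.eq_empty_of_forall_notMem ?_⟩
        rintro x ⟨hx, rfl | hxF⟩
        · exact hbs' hx
        · exact (Set.eq_empty_iff_forall_notMem.1 hsF x) ⟨hss hx, hxF⟩
  obtain ⟨s, hs, hsF⟩ := key _ hfin subset_rfl
  exact (hc hs _ hcap).ne_empty hsF

/-- Given elements `t l` of levels tending to infinity, there is a point of the spectrum all of
whose elements lie above `t l` for ultrafilter many `l`. -/
theorem exists_limit_point (h : IsChainOrder ge) (t : ℕ → Levels) (ht : ∀ l, l ≤ (t l).1) :
    ∃ S : Spectrum ge, ∀ z ∈ S.1, ∀ᶠ l in (hyperfilter ℕ : Filter ℕ), ge z (t l) := by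
  have hS : IsSelector ge {z | ∀ᶠ l in (hyperfilter ℕ : Filter ℕ), ge z (t l)} := by
    refine h.isSelector_of_upset (fun p q hpq hq => ?_) fun i => ?_
    · exact Eventually.mono hq fun l hl => h.trans hpq hl
    · have h1 : (⋃ x ∈ (Set.univ : Set (level i)), {l | ge ⟨i, x⟩ (t l)}) ∈ hyperfilter ℕ := by
        have h2 : ∀ᶠ l in (hyperfilter ℕ : Filter ℕ), i ≤ l :=
          (eventually_ge_atTop i).filter_mono Nat.hyperfilter_le_atTop
        refine h2.mono fun l hl => ?_
        obtain ⟨x, hx⟩ := (h.coBijective_link (hl.trans (ht l))).cosurj (t l).2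
        exact Set.mem_biUnion (Set.mem_univ x) hx
      obtain ⟨x, -, hx⟩ := (Ultrafilter.finite_biUnion_mem_iff Set.finite_univ).1 h1
      exact ⟨x, hx⟩
  obtain ⟨S, hS1, hS2⟩ := exists_minimal_selector hS
  exact ⟨⟨S, hS2⟩, fun z hz => hS1 hz⟩

/-- By minimality, every element `p` of a point `S` of the spectrum belongs to a cap that contains
no other element of `S`. -/
theorem exists_isCap (S : Spectrum ge) {p : Levels} (hp : p ∈ S.1) :
    ∃ C, IsCap ge C ∧ ∀ q ∈ S.1, q ∈ C → q = p := by
  by_contra! hcon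
  have h1 : IsSelector ge (S.1 \ {p}) := by
    intro C hC
    obtain ⟨q, hq, hqC, hqp⟩ := hcon C hC
    exact ⟨q, ⟨hq, hqp⟩, hqC⟩
  exact (S.2.2 h1 Set.sdiff_subset hp).2 rfl

theorem mem_of_ge (h : IsChainOrder ge) (S : Spectrum ge) {p q : Levels} (hpq : ge p q)
    (hq : q ∈ S.1) : p ∈ S.1 := by
  obtain ⟨C, ⟨B, hB, hBC⟩, hC⟩ := exists_isCap S hq
  -- Replacing `q` by the larger element `p` turns `C` into another cap.
  obtain ⟨x, hx, hxC⟩ := S.2.1 (insert p (C \ {q})) ⟨B, hB, fun b hb => by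
    obtain ⟨c, hc, hcb⟩ := hBC b hb
    by_cases hcq : c = q
    · exact ⟨p, Set.mem_insert _ _, h.trans hpq (hcq ▸ hcb)⟩
    · exact ⟨c, Set.mem_insert_of_mem _ ⟨hc, hcq⟩, hcb⟩⟩
  rcases hxC with rfl | ⟨hxC, hxq⟩
  · exact hx
  · exact absurd (hC x hx hxC) hxq

theorem exists_mem_below (h : IsChainOrder ge) (S : Spectrum ge) {i j : ℕ} (hij : i ≤ j)
    {x : level i} (hx : ⟨i, x⟩ ∈ S.1) : ∃ y : level j, link ge i j x y ∧ ⟨j, y⟩ ∈ S.1 := by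
  obtain ⟨C, hC, hCS⟩ := exists_isCap S hx
  obtain ⟨k, hk⟩ := h.exists_level_of_isCap hC
  obtain ⟨z, hz⟩ := h.exists_mem_level S.2.1 (max k j)
  obtain ⟨c, hc, hcz⟩ := hk _ (le_max_left _ _) z
  obtain rfl := hCS c (h.mem_of_ge S hcz hz) hc
  have hcz' : link ge i (max k j) x z := hcz
  rw [← h.link_comp hij (le_max_right _ _)] at hcz'
  obtain ⟨y, hxy, hyz⟩ := hcz'
  exact ⟨y, hxy, h.mem_of_ge S hyz hz⟩

end IsChainOrder

/-- The topology of the spectrum, in which the sets of all points containing a given element form a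
subbasis. -/
@[reducible]
def Spectrum.topology (ge : Levels → Levels → Prop) : TopologicalSpace (Spectrum ge) :=
  .generateFrom {U | ∃ p, U = {S | p ∈ S.1}}

/-- If `t` and `S` are as in `IsChainOrder.exists_limit_point`, then the basic open sets given by
the elements `t l` are small near `S`. -/
theorem IsChainOrder.eventually_subset {ge : Levels → Levels → Prop} (h : IsChainOrder ge)
    {t : ℕ → Levels} {S : Spectrum ge}
    (hS : ∀ z ∈ S.1, ∀ᶠ l in (hyperfilter ℕ : Filter ℕ), ge z (t l)) {U : Set (Spectrum ge)}
    (hU : IsOpen[Spectrum.topology ge] U) (hSU : S ∈ U) :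
    ∀ᶠ l in (hyperfilter ℕ : Filter ℕ), {S' : Spectrum ge | t l ∈ S'.1} ⊆ U := by
  induction hU with
  | basic U hU =>
    obtain ⟨p, rfl⟩ := hU
    exact (hS p hSU).mono fun l hl S' hS' => h.mem_of_ge S' hl hS'
  | univ => exact .of_forall fun l => Set.subset_univ _
  | inter U V _ _ ihU ihV =>
    filter_upwards [ihU hSU.1, ihV hSU.2] with l h1 h2 using Set.subset_inter h1 h2
  | sUnion 𝒰 _ ih =>
    obtain ⟨U, hU, hSU⟩ := hSU
    exact (ih U hU hSU).mono fun l hl => hl.trans (Set.subset_sUnion_of_mem hU)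

/-- Open covers of the spectrum are refined by the cover given by some level. -/
theorem IsChainOrder.exists_level_refining {ge : Levels → Levels → Prop} (h : IsChainOrder ge)
    {𝒰 : Set (Set (Spectrum ge))} (h𝒰 : ∀ U ∈ 𝒰, IsOpen[Spectrum.topology ge] U)
    (hcov : ⋃₀ 𝒰 = Set.univ) :
    ∃ i, ∀ x : level i, ∃ U ∈ 𝒰, {S : Spectrum ge | ⟨i, x⟩ ∈ S.1} ⊆ U := by
  by_contra! hcon
  choose t ht using hcon
  obtain ⟨S, hS⟩ := h.exists_limit_point (fun l => ⟨l, t l⟩) fun l => le_rfl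
  obtain ⟨U, hU, hSU⟩ := Set.eq_univ_iff_forall.1 hcov S
  obtain ⟨l, hl⟩ := (h.eventually_subset hS (h𝒰 U hU) hSU).exists
  exact ht l U hU hl

/-! ### The structure of a code -/

namespace Code

variable {μ : Code L}

theorem core_eq_comp (h : IsChainOrder μ.ge) {i j : ℕ} (hij : i ≤ j) :
    μ.core i = Comp (link μ.ge i j) (μ.core j) := by
  funext x S
  refine propext ⟨fun hx => h.exists_mem_below S hij hx, ?_⟩
  rintro ⟨y, hxy, hy⟩
  exact h.mem_of_ge S hxy hy

theorem coBijective_core (h : IsChainOrder μ.ge) (i : ℕ) : CoBijective (μ.core i) := by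
  refine ⟨fun x => ?_, fun S => h.exists_mem_level S.2.1 i⟩
  choose y hy using fun n => (h.coBijective_link (Nat.le_add_right i n)).coinj x
  obtain ⟨S, hS⟩ := h.exists_limit_point (fun n => ⟨i + n, y n⟩) fun n => Nat.le_add_left _ _
  have hx : ∀ x', μ.core i x' S → x' = x := by
    intro x' hx'
    obtain ⟨n, hn⟩ := (hS _ hx').exists
    exact (hy n).2 x' hn
  obtain ⟨x', hx'⟩ := h.exists_mem_level S.2.1 i
  exact ⟨S, hx x' hx' ▸ hx', hx⟩

variable [L.IsRelational]

theorem comp_core_mem (h : IsChainOrder μ.ge) {X : Finset ℕ} {i : ℕ} {r : X → level i → Prop}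
    (hr : CoBijective r) : Comp r (μ.core i) ∈ μ.model.V X :=
  ⟨hr.comp (coBijective_core h i), i, r, hr, rfl⟩

theorem core_mem (h : IsChainOrder μ.ge) (i : ℕ) : μ.core i ∈ μ.model.V (level i) := by
  have := comp_core_mem h (CoBijective.eq (X := level i))
  rwa [eq_comp] at this

/-- Admissible co-valuations of `M_μ` are consolidations of all late members of the core. -/
theorem exists_comp_core (h : IsChainOrder μ.ge) {X : Finset ℕ} {v : X → μ.model.carrier → Prop}
    (hv : v ∈ μ.model.V X) : ∃ i, ∀ j, i ≤ j → ∃ r : X → level j → Prop, CoBijective r ∧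
      v = Comp r (μ.core j) := by
  obtain ⟨-, i, r, hr, rfl⟩ := hv
  refine ⟨i, fun j hij => ⟨Comp r (link μ.ge i j), hr.comp (h.coBijective_link hij), ?_⟩⟩
  rw [comp_assoc, ← core_eq_comp h hij]

theorem model_isCompact (h : IsChainOrder μ.ge) : μ.model.IsCompact := by
  let τ : TopologicalSpace μ.model.carrier := Spectrum.topology μ.ge
  have hop : ∀ p : Levels, IsOpen {S : μ.model.carrier | p ∈ S.1} := fun p => .basic _ ⟨p, rfl⟩
  refine ⟨τ, ⟨?_⟩, ⟨fun S => ?_⟩, ?_, ?_, ?_⟩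
  · refine isCompact_of_finite_subcover fun {ι} U hU hcov => ?_
    obtain ⟨i, hi⟩ := h.exists_level_refining (𝒰 := Set.range U)
      (by rintro _ ⟨k, rfl⟩; exact hU k) (Set.univ_subset_iff.1 hcov)
    have : ∀ x : level i, ∃ k, {S : Spectrum μ.ge | (⟨i, x⟩ : Levels) ∈ S.1} ⊆ U k := by
      intro x
      obtain ⟨_, ⟨k, rfl⟩, hk⟩ := hi x
      exact ⟨k, hk⟩
    choose k hk using this
    classical
    refine ⟨Finset.univ.image k, fun S _ => ?_⟩
    obtain ⟨x, hx⟩ := h.exists_mem_level S.2.1 i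
    exact Set.mem_biUnion (Finset.mem_coe.2 (Finset.mem_image_of_mem k (Finset.mem_univ x)))
      (hk x hx)
  · rw [← isOpen_compl_iff]
    have : ({S}ᶜ : Set μ.model.carrier) = ⋃ p ∈ S.1ᶜ, {S' : μ.model.carrier | p ∈ S'.1} := by
      ext S'
      simp only [Set.mem_compl_iff, Set.mem_singleton_iff, Set.mem_iUnion, Set.mem_ofPred_eq,
        exists_prop]
      constructor
      · intro hne
        by_contra! hcon
        refine hne (Subtype.ext (Set.Subset.antisymm (fun p hp => ?_) ?_))
        · by_contra hpS
          exact hcon p hpS hp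
        · exact S.2.2 S'.2.1 fun p hp => by_contra fun hpS => hcon p hpS hp
      · rintro ⟨p, hp, hp'⟩ rfl
        exact hp hp'
    rw [this]
    exact isOpen_biUnion fun p _ => hop p
  · rintro X v ⟨-, i, r, hr, rfl⟩ x
    have : {S : μ.model.carrier | Comp r (μ.core i) x S} =
        ⋃ y ∈ {y | r x y}, {S : μ.model.carrier | (⟨i, y⟩ : Levels) ∈ S.1} := by
      ext S
      simp [Comp, Code.core]
    rw [this]
    exact isOpen_biUnion fun y _ => hop _
  · intro 𝒰 h𝒰 hcov
    obtain ⟨i, hi⟩ := h.exists_level_refining h𝒰 hcov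
    exact ⟨_, _, core_mem h i, hi⟩
  · intro m R
    have : {a : Fin m → μ.model.carrier | μ.model.Holds R a} =
        ⋂ c ∈ {c : Σ i, Fin m → level i | ¬ μ.b R c.1 c.2},
          (⋂ k, (fun a : Fin m → μ.model.carrier => a k) ⁻¹'
            {S : μ.model.carrier | (⟨c.1, c.2 k⟩ : Levels) ∈ S.1})ᶜ := by
      ext a
      simp only [Set.mem_ofPred_eq, Set.mem_iInter, Set.mem_compl_iff, Set.mem_preimage,
        Sigma.forall]
      exact forall₂_congr fun i x => not_imp_not.symm
    rw [this]
    refine isClosed_biInter fun c _ => (isOpen_iInter_of_finite fun k => ?_).isClosed_compl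
    exact (hop _).preimage (continuous_apply k)

theorem model_isOmega (h : IsChainOrder μ.ge) : μ.model.IsOmega := by
  refine ⟨level, μ.core, core_mem h, fun i => ?_, fun X v hv => ?_⟩
  · exact ⟨_, h.coBijective_link (Nat.le_succ i), core_eq_comp h (Nat.le_succ i)⟩
  · obtain ⟨-, i, r, hr, rfl⟩ := hv
    exact ⟨i, r, hr, rfl⟩

/-- A tuple of `M_μ` satisfying `R` is obtained in the limit from tuples in `b_R` whose entries lie
below the given elements `y k` only; its entries are private points of the `y k`. -/
theorem exists_holds_of_private (hμ : μ.IsCode) {m : ℕ} {R : L.Relations m} {Y : Finset ℕ} {j : ℕ}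
    {t : Y → level j → Prop} (ht : CoBijective t) {y : Fin m → Y}
    (hz : ∀ l, j ≤ l → ∃ z : Fin m → level l, μ.b R l z ∧
      ∀ k, Priv (Comp t (link μ.ge j l)) (y k) (z k)) :
    ∃ S : Fin m → μ.model.carrier, (∀ k, Priv (Comp t (μ.core j)) (y k) (S k)) ∧
      μ.model.Holds R S := by
  have h := hμ.chain
  choose z hb hp using fun n => hz (j + n) (Nat.le_add_right j n)
  choose S hS using fun k => h.exists_limit_point (fun n => ⟨j + n, z n k⟩)
    fun n => Nat.le_add_left _ _
  refine ⟨S, fun k => ?_, fun i x hx => ?_⟩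
  · have h1 : ∀ y', Comp t (μ.core j) y' (S k) → y' = y k := by
      rintro y' ⟨c, hc, hcS⟩
      obtain ⟨n, hn⟩ := (hS k _ hcS).exists
      exact (hp n k).2 y' ⟨c, hc, hn⟩
    obtain ⟨y', hy'⟩ := (ht.comp (coBijective_core h j)).cosurj (S k)
    exact ⟨h1 y' hy' ▸ hy', h1⟩
  · obtain ⟨n, hn⟩ := (eventually_all.2 fun k => hS k _ (hx k)).exists
    exact hμ.mono R _ _ _ _ (hb n) hn

/-- For the structure of a code, only Axiom (II) has to be checked. -/
theorem model_isStructure (hμ : IsChainOrder μ.ge)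
    (hw : ∀ {m : ℕ} (R : L.Relations m) {X : Finset ℕ}, ∀ v ∈ μ.model.V X, ∀ x : Fin m → X,
      μ.model.Sat (.rel R x) v →
        ∃ (Y : Finset ℕ) (w : Y → μ.model.carrier → Prop) (y : Fin m → Y)
          (a : Fin m → μ.model.carrier), w ∈ μ.model.V Y ∧ (∀ k, Priv w (y k) (a k)) ∧
          (∀ k b, w (y k) b → v (x k) b) ∧ μ.model.Holds R a) : μ.model.IsStructure where
  nonempty := by
    have : IsSelector μ.ge Set.univ := hμ.isSelector_of_upset (fun _ _ _ _ => trivial) fun i =>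
      ⟨Classical.arbitrary _, trivial⟩
    obtain ⟨S, -, hS⟩ := IsChainOrder.exists_minimal_selector this
    exact ⟨⟨S, hS⟩⟩
  admissible_nonempty := ⟨_, _, core_mem hμ 0⟩
  directed := by
    intro X Y v hv w hw
    obtain ⟨i, hi⟩ := exists_comp_core hμ hv
    obtain ⟨j, hj⟩ := exists_comp_core hμ hw
    exact ⟨_, _, core_mem hμ (max i j), hi _ (le_max_left _ _), hj _ (le_max_right _ _)⟩
  witness := hw

end Code

/-! ### Conditions -/

/-- The substitution of a consolidation pattern into a formula. -/
noncomputable def subst {X Y : Finset ℕ} {r : Y → X → Prop} (hr : CoBijective r)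
    (φ : Formula L Y) : Formula L X :=
  (exists_subst.{uf, ur, u} φ r hr).choose

theorem sat_subst {M : ProtoStructure.{uf, ur, u} L} (hM : M.IsStructure) {X Y : Finset ℕ}
    {r : Y → X → Prop} (hr : CoBijective r) (φ : Formula L Y) {v : X → M.carrier → Prop}
    (hv : v ∈ M.V X) : M.Sat (subst.{uf, ur, u} hr φ) v ↔ M.Sat φ (Comp r v) :=
  (exists_subst.{uf, ur, u} φ r hr).choose_spec M hM v hv

instance : Unique starCtx where
  default := ⟨0, Finset.mem_singleton_self 0⟩
  uniq x := Subtype.ext (Finset.mem_singleton.1 x.2)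

theorem coBijective_true {X Y : Type*} [Subsingleton X] [Nonempty X] [Nonempty Y] :
    CoBijective (fun (_ : X) (_ : Y) => True) :=
  ⟨fun x => ⟨Classical.arbitrary Y, trivial, fun x' _ => Subsingleton.elim x' x⟩,
    fun _ => ⟨Classical.arbitrary X, trivial⟩⟩

theorem CoBijective.eq_star {Y : Type*} {v : starCtx → Y → Prop} (hv : CoBijective v) :
    v = fun _ _ => True := by
  funext x y
  obtain ⟨x', hx'⟩ := hv.cosurj y
  obtain rfl : x' = x := Subsingleton.elim _ _
  exact propext ⟨fun _ => trivial, fun _ => hx'⟩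

/-- A condition is a finite piece of information about a member `v_0, …, v_j` of a core: the bonds
between the levels up to `j` (those above `j` are irrelevant), and a formula to be true at `v_j`;
it has to be realized in some model of `T`. -/
structure Cond (T : Set (Formula L starCtx)) where
  j : ℕ
  g : Bonds
  hg : ∀ i, CoBijective (g i)
  ψ : Formula L (level j)
  con : ∃ M : ProtoStructure.{uf, ur, u} L, M.IsModel T ∧ ∃ v ∈ M.V (level j), M.Sat ψ v

namespace Cond

variable {T : Set (Formula L starCtx)}

/-- `q'` extends `q`: it has the same bonds below `q.j`, and its formula implies that of `q`. -/
def Ext (q' q : Cond.{uf, ur, u} T) : Prop :=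
  q.j ≤ q'.j ∧ (∀ i < q.j, q'.g i = q.g i) ∧
    ∀ M : ProtoStructure.{uf, ur, u} L, M.IsModel T → ∀ v ∈ M.V (level q'.j),
      M.Sat q'.ψ v → M.Sat q.ψ (Comp (link q'.g.ge q.j q'.j) v)

/-- `q` forces `φ` at the consolidation of the `i`-th member of the core with pattern `r`. -/
def Forces (q : Cond.{uf, ur, u} T) {X : Finset ℕ} {i : ℕ} (r : X → level i → Prop)
    (φ : Formula L X) : Prop :=
  i ≤ q.j ∧ ∀ M : ProtoStructure.{uf, ur, u} L, M.IsModel T → ∀ v ∈ M.V (level q.j),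
    M.Sat q.ψ v → M.Sat φ (Comp (Comp r (link q.g.ge i q.j)) v)

theorem link_mem (q : Cond.{uf, ur, u} T) {M : ProtoStructure.{uf, ur, u} L} {i : ℕ}
    (hi : i ≤ q.j) {v : level q.j → M.carrier → Prop} (hv : v ∈ M.V (level q.j)) :
    Comp (link q.g.ge i q.j) v ∈ M.V (level i) :=
  M.closed _ (q.g.coBijective_link q.hg hi) hv

theorem Ext.refl (q : Cond.{uf, ur, u} T) : Ext q q :=
  ⟨le_rfl, fun _ _ => rfl, fun M hM v hv h => by rwa [Bonds.link_self, eq_comp]⟩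

theorem Ext.link_eq {q' q : Cond.{uf, ur, u} T} (h : Ext q' q) (i : ℕ) :
    link q'.g.ge i q.j = link q.g.ge i q.j :=
  Bonds.link_congr fun k _ hk => h.2.1 k hk

theorem Ext.trans {q'' q' q : Cond.{uf, ur, u} T} (h : Ext q'' q') (h' : Ext q' q) :
    Ext q'' q := by
  refine ⟨h'.1.trans h.1, fun i hi => (h.2.1 i (hi.trans_le h'.1)).trans (h'.2.1 i hi), ?_⟩
  intro M hM v hv hs
  have := h'.2.2 M hM _ (M.closed _ (q''.g.coBijective_link q''.hg h.1) hv) (h.2.2 M hM v hv hs)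
  rwa [← h.link_eq, ← comp_assoc, Bonds.link_comp _ h'.1 h.1] at this

theorem Forces.mono {q' q : Cond.{uf, ur, u} T} (h : Ext q' q) {X : Finset ℕ} {i : ℕ}
    {r : X → level i → Prop} {φ : Formula L X} (hf : q.Forces r φ) : q'.Forces r φ := by
  refine ⟨hf.1.trans h.1, fun M hM v hv hs => ?_⟩
  have := hf.2 M hM _ (M.closed _ (q'.g.coBijective_link q'.hg h.1) hv) (h.2.2 M hM v hv hs)
  rwa [← h.link_eq, ← comp_assoc, comp_assoc (r := r), Bonds.link_comp _ hf.1 h.1] at this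

/-- The extension of `q` by new bonds and a further formula `θ`. -/
noncomputable def refine (q : Cond.{uf, ur, u} T) {j : ℕ} {g : Bonds} (hj : q.j ≤ j)
    (hg : ∀ i, CoBijective (g i)) (θ : Formula L (level j))
    (con : ∃ M : ProtoStructure.{uf, ur, u} L, M.IsModel T ∧ ∃ v ∈ M.V (level j),
      M.Sat q.ψ (Comp (link g.ge q.j j) v) ∧ M.Sat θ v) : Cond.{uf, ur, u} T where
  j := j
  g := g
  hg := hg
  ψ := (subst.{uf, ur, u} (g.coBijective_link hg hj) q.ψ).and θ
  con := by
    obtain ⟨M, hM, v, hv, h1, h2⟩ := con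
    exact ⟨M, hM, v, hv, (sat_subst hM.1 _ _ hv).2 h1, h2⟩

section refine

variable (q : Cond.{uf, ur, u} T) {j : ℕ} {g : Bonds} (hj : q.j ≤ j)
  (hg : ∀ i, CoBijective (g i)) (θ : Formula L (level j))
  (con : ∃ M : ProtoStructure.{uf, ur, u} L, M.IsModel T ∧ ∃ v ∈ M.V (level j),
      M.Sat q.ψ (Comp (link g.ge q.j j) v) ∧ M.Sat θ v)

theorem refine_ext (hag : ∀ i < q.j, g i = q.g i) : Ext (q.refine hj hg θ con) q :=
  ⟨hj, hag, fun _ hM _ hv h => (sat_subst hM.1 _ _ hv).1 h.1⟩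

theorem refine_forces {X : Finset ℕ} {i : ℕ} (hi : i ≤ j) {r : X → level i → Prop}
    {φ : Formula L X} (h : ∀ M : ProtoStructure.{uf, ur, u} L, M.IsModel T → ∀ v ∈ M.V (level j),
      M.Sat θ v → M.Sat φ (Comp (Comp r (link g.ge i j)) v)) :
    (q.refine hj hg θ con).Forces r φ :=
  ⟨hi, fun M hM v hv hs => h M hM v hv hs.2⟩

end refine

/-- The formula of a condition can be strengthened by any formula at a consolidation of a member
of the core, if the result is still realized. -/
theorem exists_ext_forces (q : Cond.{uf, ur, u} T) {X : Finset ℕ} {i : ℕ} (hi : i ≤ q.j)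
    {r : X → level i → Prop} (hr : CoBijective r) (φ : Formula L X)
    {M : ProtoStructure.{uf, ur, u} L} (hM : M.IsModel T) {v : level q.j → M.carrier → Prop}
    (hv : v ∈ M.V (level q.j)) (hs : M.Sat q.ψ v)
    (hφ : M.Sat φ (Comp (Comp r (link q.g.ge i q.j)) v)) : ∃ q', Ext q' q ∧ q'.Forces r φ := by
  have hr' := hr.comp (q.g.coBijective_link q.hg hi)
  refine ⟨q.refine le_rfl q.hg (subst.{uf, ur, u} hr' φ) ⟨M, hM, v, hv, ?_, ?_⟩,
    refine_ext _ _ _ _ _ fun _ _ => rfl, refine_forces _ _ _ _ _ hi ?_⟩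
  · rwa [Bonds.link_self, eq_comp]
  · exact (sat_subst hM.1 _ _ hv).2 hφ
  · exact fun M hM v hv h => (sat_subst hM.1 _ _ hv).1 h

theorem exists_ext_decides (q : Cond.{uf, ur, u} T) {X : Finset ℕ} {i : ℕ} (hi : i ≤ q.j)
    {r : X → level i → Prop} (hr : CoBijective r) (φ : Formula L X) :
    ∃ q', Ext q' q ∧ (q'.Forces r φ ∨ q'.Forces r φ.neg) := by
  obtain ⟨M, hM, v, hv, hs⟩ := q.con
  by_cases hφ : M.Sat φ (Comp (Comp r (link q.g.ge i q.j)) v)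
  · obtain ⟨q', h1, h2⟩ := q.exists_ext_forces hi hr φ hM hv hs hφ
    exact ⟨q', h1, .inl h2⟩
  · obtain ⟨q', h1, h2⟩ := q.exists_ext_forces hi hr φ.neg hM hv hs hφ
    exact ⟨q', h1, .inr h2⟩

/-- If a condition is realized by `v` in `M` and `w` is admissible in `M`, then the chain can be
continued within `M` to a common fragmentation of `v` and `w` in a high level. The level has to be
high enough to contain a common fragmentation; then the sizes are adjusted by interpolation. -/
theorem exists_continuation [L.IsRelational]
    (hinf : ∀ M : ProtoStructure.{uf, ur, u} L, M.IsCompactOmegaModel T → Infinite M.carrier)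
    (q : Cond.{uf, ur, u} T) {M : ProtoStructure.{uf, ur, u} L}
    (hM : M.IsModel T) {v : level q.j → M.carrier → Prop} (hv : v ∈ M.V (level q.j))
    {W : Finset ℕ} {w : W → M.carrier → Prop} (hw : w ∈ M.V W) (N : ℕ) :
    ∃ (j : ℕ) (g : Bonds) (v' : level j → M.carrier → Prop) (t : W → level j → Prop),
      N ≤ j ∧ q.j ≤ j ∧ (∀ i, CoBijective (g i)) ∧ (∀ i < q.j, g i = q.g i) ∧
      v' ∈ M.V (level j) ∧ v = Comp (link g.ge q.j j) v' ∧ CoBijective t ∧ w = Comp t v' := by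
  obtain ⟨Z, z, hz, ⟨a, ha, rfl⟩, ⟨b, hb, rfl⟩⟩ := hM.1.directed v hv w hw
  set j := max (max (q.j + 1) N) Z.card with hj
  obtain ⟨Z₁, hZ₁, z₁, hz₁⟩ := exists_large_coval hinf hM (levelCard j)
  obtain ⟨Z₂, z₂, hz₂, ⟨c, hc, rfl⟩, ⟨d, hd, rfl⟩⟩ := hM.1.directed z hz z₁ hz₁
  obtain ⟨s, t, hs, ht, rfl⟩ := hc.interpolate (Y := level j)
    (by
      rw [card_level, Nat.card_eq_fintype_card, Fintype.card_coe]
      exact (le_max_right _ _).trans levelCard_strictMono.le_apply)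
    (by
      rw [card_level]
      refine hZ₁.trans ?_
      simpa using hd.card_le)
  obtain ⟨g, h1, h2, h3⟩ := q.g.exists_link_eq q.hg
    (show q.j < j by rw [hj]; simp only [lt_max_iff]; left; left; omega) (ha.comp hs)
  refine ⟨j, g, Comp t z₂, Comp b s, (le_max_right _ _).trans (le_max_left _ _), ?_, h1, h2,
    M.closed _ ht hz₂, ?_, hb.comp hs, ?_⟩
  · exact (Nat.le_succ _).trans ((le_max_left _ _).trans (le_max_left _ _))
  · rw [h3]
    simp only [comp_assoc]
  · simp only [comp_assoc]

theorem exists_ext_level [L.IsRelational]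
    (hinf : ∀ M : ProtoStructure.{uf, ur, u} L, M.IsCompactOmegaModel T → Infinite M.carrier)
    (q : Cond.{uf, ur, u} T) (N : ℕ) : ∃ q', Ext q' q ∧ N ≤ q'.j := by
  obtain ⟨M, hM, v, hv, hs⟩ := q.con
  obtain ⟨j, g, v', t, hN, hj, hg, hag, hv', rfl, -, -⟩ := exists_continuation hinf q hM hv hv N
  exact ⟨q.refine hj hg (.neg .bot) ⟨M, hM, v', hv', hs, id⟩, refine_ext _ _ _ _ _ hag, hN⟩

/-- The Henkin requirements for `φ`, at the consolidation of the `i`-th member of the core with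
pattern `r`: existential formulas are refuted or instantiated by a consolidation of a member of the
core, and atomic formulas are refuted or witnessed by a privately related tuple. -/
def Witnesses (q : Cond.{uf, ur, u} T) {X : Finset ℕ} {i : ℕ} (r : X → level i → Prop) :
    Formula L X → Prop
  | .ex (Y := Y) s hs φ => q.Forces r (Formula.ex s hs φ).neg ∨ i ≤ q.j ∧
      ∃ t : Y → level q.j → Prop, CoBijective t ∧ Comp r (link q.g.ge i q.j) = Comp s t ∧
        q.Forces t φ
  | .rel (m := m) R x => q.Forces r (Formula.rel R x).neg ∨ i ≤ q.j ∧
      ∃ (Y : Finset ℕ) (y : Fin m → Y) (t : Y → level q.j → Prop), CoBijective t ∧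
        (∀ k z, t (y k) z → Comp r (link q.g.ge i q.j) (x k) z) ∧
        q.Forces t (privateFormula.{uf, ur, u} R y)
  | _ => True

theorem exists_ext_witnesses [L.IsRelational]
    (hinf : ∀ M : ProtoStructure.{uf, ur, u} L, M.IsCompactOmegaModel T → Infinite M.carrier)
    (q : Cond.{uf, ur, u} T) {X : Finset ℕ} {i : ℕ} (hi : i ≤ q.j)
    {r : X → level i → Prop} (hr : CoBijective r) (φ : Formula L X) :
    ∃ q', Ext q' q ∧ q'.Witnesses r φ := by
  obtain ⟨M, hM, v, hv, hs⟩ := q.con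
  by_cases hφ : M.Sat φ (Comp (Comp r (link q.g.ge i q.j)) v)
  swap
  · obtain ⟨q', h1, h2⟩ := q.exists_ext_forces hi hr φ.neg hM hv hs hφ
    refine ⟨q', h1, ?_⟩
    cases φ <;> first | trivial | exact .inl h2
  cases φ with
  | rel R x =>
    obtain ⟨Y, w, y, a, hw, h1, h2, h3⟩ := hM.1.witness R _
      (M.closed _ (hr.comp (q.g.coBijective_link q.hg hi)) hv) x hφ
    obtain ⟨j, g, v', t, -, hj, hg, hag, hv', rfl, ht, rfl⟩ :=
      exists_continuation hinf q hM hv hw 0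
    refine ⟨q.refine hj hg (subst.{uf, ur, u} ht (privateFormula.{uf, ur, u} R y))
      ⟨M, hM, v', hv', hs, ?_⟩, refine_ext _ _ _ _ _ hag, .inr ⟨hi.trans hj, Y, y, t, ht, ?_, ?_⟩⟩
    · exact (sat_subst hM.1 _ _ hv').2 ((M.sat_privateFormula R y _).2
        (M.privatelyRelated_of_priv h1 h3))
    · intro k z hz
      have hlink : link q.g.ge i q.j = link g.ge i q.j :=
        Bonds.link_congr fun l _ hl => (hag l hl).symm
      have h4 := (comp_mono_iff (M.coval hv') (x := y k) (x' := x k)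
        (s := Comp r (link g.ge i j))).1 (fun b hb => by
          have := h2 k b hb
          rwa [hlink, ← comp_assoc, comp_assoc (r := r), Bonds.link_comp _ hi hj] at this)
      exact h4 z hz
    · refine refine_forces _ _ _ _ _ le_rfl fun M hM v hv h => ?_
      rw [Bonds.link_self, comp_eq]
      exact (sat_subst hM.1 _ _ hv).1 h
  | @ex _ Y s hs' φ =>
    obtain ⟨w, hw, h1, h2⟩ := hφ
    obtain ⟨j, g, v', t, -, hj, hg, hag, hv', rfl, ht, rfl⟩ :=
      exists_continuation hinf q hM hv hw 0
    refine ⟨q.refine hj hg (subst.{uf, ur, u} ht φ)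
      ⟨M, hM, v', hv', hs, (sat_subst hM.1 _ _ hv').2 h2⟩, refine_ext _ _ _ _ _ hag,
      .inr ⟨hi.trans hj, t, ht, comp_right_cancel (M.coval hv') ?_, ?_⟩⟩
    · have hlink : link q.g.ge i q.j = link g.ge i q.j :=
        Bonds.link_congr fun l _ hl => (hag l hl).symm
      rw [hlink, ← comp_assoc, comp_assoc (r := r), Bonds.link_comp _ hi hj, ← comp_assoc] at h1
      exact h1
    · refine refine_forces _ _ _ _ _ le_rfl fun M hM v hv h => ?_
      rw [Bonds.link_self, comp_eq]
      exact (sat_subst hM.1 _ _ hv).1 h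
  | _ => exact ⟨q, .refl q, trivial⟩

end Cond

/-! ### Generic sequences of conditions -/

/-- Sequences of conditions that meet the countably many dense requirements needed to read off a
code from them. -/
structure IsGeneric {T : Set (Formula L starCtx)} (q : ℕ → Cond.{uf, ur, u} T) : Prop where
  ext : ∀ n, Cond.Ext (q (n + 1)) (q n)
  exists_level : ∀ N, ∃ n, N ≤ (q n).j
  decides : ∀ {X : Finset ℕ} {i : ℕ} (r : X → level i → Prop), CoBijective r → ∀ φ : Formula L X,
    ∃ n, (q n).Forces r φ ∨ (q n).Forces r φ.neg
  witnesses : ∀ {X : Finset ℕ} {i : ℕ} (r : X → level i → Prop), CoBijective r →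
    ∀ φ : Formula L X, ∃ n, (q n).Witnesses r φ

theorem exists_seq_meeting {T : Set (Formula L starCtx)} (q₀ : Cond.{uf, ur, u} T)
    {ι : Type*} [Countable ι] (D : ι → Cond.{uf, ur, u} T → Prop)
    (hD : ∀ i q, ∃ q', Cond.Ext q' q ∧ D i q') :
    ∃ q : ℕ → Cond.{uf, ur, u} T, q 0 = q₀ ∧ (∀ n, Cond.Ext (q (n + 1)) (q n)) ∧
      ∀ i, ∃ n, D i (q n) := by
  choose f hf hf' using hD
  rcases isEmpty_or_nonempty ι with hι | hι
  · exact ⟨fun _ => q₀, rfl, fun _ => .refl _, fun i => hι.elim i⟩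
  obtain ⟨e, he⟩ := exists_surjective_nat ι
  refine ⟨fun n => Nat.rec q₀ (fun k q => f (e k) q) n, rfl, fun n => hf _ _, fun i => ?_⟩
  obtain ⟨n, rfl⟩ := he i
  exact ⟨n + 1, hf' _ _⟩

/-- Every condition belongs to a generic sequence, which moreover meets countably many given dense
requirements. -/
theorem exists_generic [L.IsRelational] [Countable (Σ m, L.Relations m)]
    {T : Set (Formula L starCtx)}
    (hinf : ∀ M : ProtoStructure.{uf, ur, u} L, M.IsCompactOmegaModel T → Infinite M.carrier)
    (q₀ : Cond.{uf, ur, u} T) {ι : Type} [Countable ι] (D : ι → Cond.{uf, ur, u} T → Prop)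
    (hD : ∀ i q, ∃ q', Cond.Ext q' q ∧ D i q') :
    ∃ q : ℕ → Cond.{uf, ur, u} T, q 0 = q₀ ∧ IsGeneric q ∧ ∀ i, ∃ n, D i (q n) := by
  have := fun X => countable_formula (L := L) X
  let Req := Σ (X : Finset ℕ) (i : ℕ), {r : X → level i → Prop // CoBijective r} × Formula L X
  obtain ⟨q, h0, h1, h2⟩ := exists_seq_meeting q₀
    (Sum.elim (fun (N : ℕ) q => N ≤ q.j) (Sum.elim
      (fun (c : Req) q => q.Forces c.2.2.1.1 c.2.2.2 ∨ q.Forces c.2.2.1.1 c.2.2.2.neg) (Sum.elim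
        (fun (c : Req) q => q.Witnesses c.2.2.1.1 c.2.2.2) D))) (by
    rintro (N | ⟨X, i, ⟨r, hr⟩, φ⟩ | ⟨X, i, ⟨r, hr⟩, φ⟩ | k) q
    · exact Cond.exists_ext_level hinf q N
    · obtain ⟨q', h, hi⟩ := Cond.exists_ext_level hinf q i
      obtain ⟨q'', h', hf⟩ := q'.exists_ext_decides hi hr φ
      exact ⟨q'', h'.trans h, hf⟩
    · obtain ⟨q', h, hi⟩ := Cond.exists_ext_level hinf q i
      obtain ⟨q'', h', hf⟩ := Cond.exists_ext_witnesses hinf q' hi hr φ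
      exact ⟨q'', h'.trans h, hf⟩
    · exact hD k q)
  refine ⟨q, h0, ⟨h1, fun N => h2 (.inl N), fun r hr φ => h2 (.inr (.inl ⟨_, _, ⟨r, hr⟩, φ⟩)),
    fun r hr φ => h2 (.inr (.inr (.inl ⟨_, _, ⟨r, hr⟩, φ⟩)))⟩, fun i => h2 (.inr (.inr (.inr i)))⟩

/-! ### The code of a generic sequence -/

/-- `φ` is forced by some member of the sequence. -/
def Forced {T : Set (Formula L starCtx)} (q : ℕ → Cond.{uf, ur, u} T) {X : Finset ℕ} {i : ℕ}
    (r : X → level i → Prop) (φ : Formula L X) : Prop :=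
  ∃ n, (q n).Forces r φ

namespace IsGeneric

variable {T : Set (Formula L starCtx)} {q : ℕ → Cond.{uf, ur, u} T}

theorem ext_le (hq : IsGeneric q) {n m : ℕ} (h : n ≤ m) : Cond.Ext (q m) (q n) := by
  induction m, h using Nat.le_induction with
  | base => exact .refl _
  | succ m _ ih => exact (hq.ext m).trans ih

theorem forces_mono (hq : IsGeneric q) {n m : ℕ} (h : n ≤ m) {X : Finset ℕ} {i : ℕ}
    {r : X → level i → Prop} {φ : Formula L X} (hf : (q n).Forces r φ) : (q m).Forces r φ :=
  hf.mono (hq.ext_le h)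

theorem exists_level_of_le (hq : IsGeneric q) (N k : ℕ) : ∃ n, N ≤ (q n).j ∧ k ≤ n := by
  obtain ⟨n, hn⟩ := hq.exists_level N
  exact ⟨max n k, hn.trans (hq.ext_le (le_max_left n k)).1, le_max_right n k⟩

theorem not_forced_bot {X : Finset ℕ} {i : ℕ} {r : X → level i → Prop} :
    ¬ Forced q r (.bot : Formula L X) := by
  rintro ⟨n, -, hn⟩
  obtain ⟨M, hM, v, hv, hs⟩ := (q n).con
  exact hn M hM v hv hs

theorem forced_neg_iff (hq : IsGeneric q) {X : Finset ℕ} {i : ℕ} {r : X → level i → Prop}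
    (hr : CoBijective r) (φ : Formula L X) : Forced q r φ.neg ↔ ¬ Forced q r φ := by
  constructor
  · rintro ⟨n, hn⟩ ⟨m, hm⟩
    obtain ⟨M, hM, v, hv, hs⟩ := (q (max n m)).con
    exact (hq.forces_mono (le_max_left n m) hn).2 M hM v hv hs
      ((hq.forces_mono (le_max_right n m) hm).2 M hM v hv hs)
  · intro h
    obtain ⟨n, hn | hn⟩ := hq.decides r hr φ
    · exact absurd ⟨n, hn⟩ h
    · exact ⟨n, hn⟩

/-- Finitely many formulas that are forced are forced by the same member of the sequence. -/
theorem exists_forces_of_finite (hq : IsGeneric q) {ι : Type*} [Finite ι] {P : ι → Prop}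
    {X : Finset ℕ} {i : ℕ} {r : X → level i → Prop} {φ : ι → Formula L X}
    (h : ∀ k, P k → Forced q r (φ k)) : ∃ N, ∀ k, P k → (q N).Forces r (φ k) := by
  choose! n hn using h
  obtain ⟨N, hN⟩ := Finite.exists_le n
  exact ⟨N, fun k hk => hq.forces_mono (hN k) (hn k hk)⟩

/-- The bonds of a generic sequence. -/
noncomputable def bonds (hq : IsGeneric q) : Bonds := fun i =>
  (q (hq.exists_level (i + 1)).choose).g i

theorem bonds_eq (hq : IsGeneric q) {n i : ℕ} (hi : i < (q n).j) : (q n).g i = hq.bonds i := by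
  have h := (hq.exists_level (i + 1)).choose_spec
  rcases le_total n (hq.exists_level (i + 1)).choose with hle | hle
  · exact ((hq.ext_le hle).2.1 i hi).symm
  · exact (hq.ext_le hle).2.1 i h

theorem coBijective_bonds (hq : IsGeneric q) (i : ℕ) : CoBijective (hq.bonds i) :=
  (q _).hg i

theorem link_eq (hq : IsGeneric q) (i n : ℕ) :
    link (q n).g.ge i (q n).j = link hq.bonds.ge i (q n).j :=
  Bonds.link_congr fun _ _ hk => hq.bonds_eq hk

/-- The code of a generic sequence: its relations are the atomic formulas that are forced. -/
noncomputable def code (hq : IsGeneric q) : Code L where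
  ge := hq.bonds.ge
  b R i x := Forced q (Eq : level i → level i → Prop) (.rel R x)

theorem isChainOrder (hq : IsGeneric q) : IsChainOrder hq.code.ge :=
  Bonds.isChainOrder hq.coBijective_bonds

theorem link_code (hq : IsGeneric q) (i n : ℕ) :
    link (q n).g.ge i (q n).j = link hq.code.ge i (q n).j :=
  hq.link_eq i n

theorem isCode (hq : IsGeneric q) : hq.code.IsCode := by
  refine ⟨hq.isChainOrder, fun {m} R i j y x hy hxy => ?_⟩
  obtain ⟨n, hn⟩ := hy
  obtain ⟨n', hn'1, hn'2⟩ := hq.exists_level_of_le j n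
  refine ⟨n', hn'1, fun M hM v hv hs => ?_⟩
  obtain ⟨a, ha, hR⟩ := (hq.forces_mono hn'2 hn).2 M hM v hv hs
  refine ⟨a, fun k => ?_, hR⟩
  obtain ⟨z, hz, hza⟩ := ha k
  rw [eq_comp, hq.link_code] at hz
  refine ⟨z, ?_, hza⟩
  rw [eq_comp, hq.link_code]
  exact hq.isChainOrder.trans (hxy k) hz

variable [L.IsRelational]

/-- If an atomic formula is forced, then it is witnessed in the spectrum by private points of the
sets given by some admissible co-valuation. -/
theorem exists_witness (hq : IsGeneric q) {X : Finset ℕ} {i : ℕ} {r : X → level i → Prop}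
    (hr : CoBijective r) {m : ℕ} {R : L.Relations m} {x : Fin m → X}
    (hf : Forced q r (.rel R x)) :
    ∃ (Y : Finset ℕ) (w : Y → hq.code.model.carrier → Prop) (y : Fin m → Y)
      (a : Fin m → hq.code.model.carrier), w ∈ hq.code.model.V Y ∧ (∀ k, Priv w (y k) (a k)) ∧
      (∀ k b, w (y k) b → Comp r (hq.code.core i) (x k) b) ∧ hq.code.model.Holds R a := by
  have h := hq.isChainOrder
  obtain ⟨n, hn | ⟨hi, Y, y, t, ht, htx, hp⟩⟩ := hq.witnesses r hr (.rel R x)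
  · exact absurd hf ((hq.forced_neg_iff hr _).1 ⟨n, hn⟩)
  obtain ⟨S, hS, hR⟩ := Code.exists_holds_of_private hq.isCode (R := R) ht (y := y) (by
    intro l hl
    by_contra! hcon
    -- Otherwise, all `R z` with `z` privately below `y` are refuted by a single condition.
    have hcon' : ∀ z : Fin m → level l, (∀ k, Priv (Comp t (link hq.code.ge (q n).j l)) (y k) (z k))
        → Forced q (Eq : level l → level l → Prop) (Formula.rel R z).neg := by
      intro z hz
      refine (hq.forced_neg_iff .eq _).2 fun hb => ?_
      obtain ⟨k, hk⟩ := hcon z hb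
      exact hk (hz k)
    obtain ⟨N, hN⟩ := hq.exists_forces_of_finite hcon'
    obtain ⟨N', hl', hN'⟩ := hq.exists_level_of_le l (max N n)
    obtain ⟨M, hM, v, hv, hs⟩ := (q N').con
    have hpr := (M.sat_privateFormula R y _).1
      ((hq.forces_mono ((le_max_right _ _).trans hN') hp).2 M hM v hv hs)
    obtain ⟨z, hz, hzR⟩ := hpr _ (Comp (link hq.code.ge l (q N').j) v)
      (Comp t (link hq.code.ge (q n).j l)) (hq.link_code l N' ▸ (q N').link_mem hl' hv)
      (ht.comp (h.coBijective_link hl)) (by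
        rw [hq.link_code, ← h.link_comp hl hl']
        simp only [comp_assoc])
    refine (hq.forces_mono ((le_max_left _ _).trans hN') (hN z hz)).2 M hM v hv hs ?_
    rwa [eq_comp, hq.link_code])
  refine ⟨Y, _, y, S, Code.comp_core_mem h ht, hS, fun k b => ?_, hR⟩
  rw [Code.core_eq_comp h hi, ← comp_assoc, ← hq.link_code]
  exact (comp_mono_iff (Code.coBijective_core h _)).2 (htx k) b

/-- The truth lemma: what is true in the structure of the generic code is what is forced. -/
theorem sat_iff_forced (hq : IsGeneric q) {X : Finset ℕ} (φ : Formula L X) :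
    ∀ {i : ℕ} {r : X → level i → Prop}, CoBijective r →
      (hq.code.model.Sat φ (Comp r (hq.code.core i)) ↔ Forced q r φ) := by
  have h := hq.isChainOrder
  induction φ with
  | bot => exact fun _ => ⟨False.elim, fun hf => not_forced_bot hf⟩
  | rel R x =>
    intro i r hr
    constructor
    · rintro ⟨S, hS, hR⟩
      choose y hy using hS
      obtain ⟨n, hi, hn⟩ := hR i y fun k => (hy k).2
      refine ⟨n, hi, fun M hM v hv hs => ?_⟩
      obtain ⟨a, ha, hR'⟩ := hn M hM v hv hs
      refine ⟨a, fun k => ?_, hR'⟩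
      rw [comp_assoc]
      have := ha k
      rw [eq_comp] at this
      exact ⟨y k, (hy k).1, this⟩
    · intro hf
      obtain ⟨Y, w, y, a, hw, h1, h2, h3⟩ := hq.exists_witness hr hf
      exact ⟨a, fun k => h2 k _ (h1 k).1, h3⟩
  | neg φ ih => exact fun hr => (not_congr (ih hr)).trans (hq.forced_neg_iff hr φ).symm
  | and φ ψ ih1 ih2 =>
    intro i r hr
    refine (and_congr (ih1 hr) (ih2 hr)).trans ⟨?_, ?_⟩
    · rintro ⟨⟨n, hn⟩, ⟨k, hk⟩⟩
      have h1 := hq.forces_mono (le_max_left n k) hn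
      have h2 := hq.forces_mono (le_max_right n k) hk
      exact ⟨_, h1.1, fun M hM v hv hs => ⟨h1.2 M hM v hv hs, h2.2 M hM v hv hs⟩⟩
    · rintro ⟨n, hi, hn⟩
      exact ⟨⟨n, hi, fun M hM v hv hs => (hn M hM v hv hs).1⟩,
        ⟨n, hi, fun M hM v hv hs => (hn M hM v hv hs).2⟩⟩
  | @ex X Y s hs' φ ih =>
    intro i r hr
    constructor
    · rintro ⟨w, hw, h1, h2⟩
      obtain ⟨j₀, hj₀⟩ := Code.exists_comp_core h hw
      obtain ⟨t, ht, rfl⟩ := hj₀ _ (le_max_right i j₀)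
      obtain ⟨n, hj, hn⟩ := (ih ht).1 h2
      have hi := le_max_left i j₀
      have hpat : Comp r (link hq.code.ge i (max i j₀)) = Comp s t := by
        refine comp_right_cancel (Code.coBijective_core h (max i j₀)) ?_
        exact comp_assoc.trans ((congrArg (Comp r) (Code.core_eq_comp h hi).symm).trans
          (h1.trans comp_assoc.symm))
      refine ⟨n, hi.trans hj, fun M hM v hv hs => ⟨_, M.closed _ ?_ hv, ?_, hn M hM v hv hs⟩⟩
      · exact ht.comp ((q n).g.coBijective_link (q n).hg hj)
      · rw [hq.link_code, hq.link_code, ← h.link_comp hi hj, ← comp_assoc (r := r), hpat]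
        simp only [comp_assoc]
    · intro hf
      obtain ⟨n, hn | ⟨hi, t, ht, hpat, hn⟩⟩ := hq.witnesses r hr (.ex s hs' φ)
      · exact absurd hf ((hq.forced_neg_iff hr _).1 ⟨n, hn⟩)
      · refine ⟨_, Code.comp_core_mem h ht, ?_, (ih ht).2 ⟨n, hn⟩⟩
        rw [hq.link_code] at hpat
        exact (congrArg (Comp r) (Code.core_eq_comp h hi)).trans (comp_assoc.symm.trans
          ((congrArg (Comp · (hq.code.core (q n).j)) hpat).trans comp_assoc))

theorem code_mem_modExact (hq : IsGeneric q) : hq.code ∈ ModExact L := by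
  refine ⟨hq.isCode, fun R i x => ?_⟩
  exact (hq.sat_iff_forced (.rel R x) (i := i) .eq).symm.trans
    (iff_of_eq (congrArg (hq.code.model.Sat (.rel R x)) eq_comp))

theorem model_isStructure (hq : IsGeneric q) : hq.code.model.IsStructure := by
  refine Code.model_isStructure hq.isChainOrder fun R X v hv x hx => ?_
  obtain ⟨-, i, r, hr, rfl⟩ := hv
  exact hq.exists_witness hr ((hq.sat_iff_forced _ hr).1 hx)

theorem model_isModel (hq : IsGeneric q) : hq.code.model.IsModel T := by
  refine ⟨hq.model_isStructure, _, Code.comp_core_mem hq.isChainOrder (i := 0) coBijective_true,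
    fun φ hφ => (hq.sat_iff_forced φ coBijective_true).2 ⟨0, Nat.zero_le _, ?_⟩⟩
  intro M hM v hv hs
  obtain ⟨hM', u, hu, hT⟩ := hM
  have h1 := (M.coval hu).eq_star
  have h2 := (coBijective_true.comp
    (((q 0).g.coBijective_link (q 0).hg (Nat.zero_le _)).comp (M.coval hv))).eq_star
  rw [comp_assoc, h2, ← h1]
  exact hT φ hφ

theorem model_isCompactOmegaModel (hq : IsGeneric q) : hq.code.model.IsCompactOmegaModel T :=
  ⟨hq.model_isModel, Code.model_isCompact hq.isChainOrder, Code.model_isOmega hq.isChainOrder⟩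

end IsGeneric

/-! ### Isolated types -/

namespace TypeSpace

variable {T : Set (Formula L starCtx)} {X : Finset ℕ}

theorem mem_iff_sat (p : TypeSpace.{uf, ur, u} T X) {M : ProtoStructure.{uf, ur, u} L}
    {v : X → M.carrier → Prop} (hv : ∀ φ ∈ p.1, M.Sat φ v) (φ : Formula L X) :
    φ ∈ p.1 ↔ M.Sat φ v :=
  ⟨hv φ, fun h => (p.2.1 φ).resolve_right fun hn => hv _ hn h⟩

/-- The type of an admissible co-valuation in a model of `T`. -/
def of {M : ProtoStructure.{uf, ur, u} L} (hM : M.IsModel T) {v : X → M.carrier → Prop}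
    (hv : v ∈ M.V X) : TypeSpace.{uf, ur, u} T X :=
  ⟨{φ | M.Sat φ v}, fun φ => em (M.Sat φ v), M, hM, v, hv, fun _ h => h⟩

/-- A type is isolated if and only if one of its formulas implies it in all models of `T`. -/
theorem isOpen_singleton_iff (p : TypeSpace.{uf, ur, u} T X) :
    IsOpen {p} ↔ ∃ φ ∈ p.1, ∀ M : ProtoStructure.{uf, ur, u} L, M.IsModel T → ∀ v ∈ M.V X,
      M.Sat φ v → ∀ ψ ∈ p.1, M.Sat ψ v := by
  constructor
  · obtain ⟨M, hM, v, hv, hp⟩ := p.2.2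
    have key : ∀ U : Set (TypeSpace.{uf, ur, u} T X), IsOpen U → p ∈ U →
        ∃ φ ∈ p.1, ∀ q : TypeSpace.{uf, ur, u} T X, φ ∈ q.1 → q ∈ U := by
      intro U hU
      induction hU with
      | basic U hU =>
        obtain ⟨φ, rfl⟩ := hU
        exact fun hpU => ⟨φ, hpU, fun _ h => h⟩
      | univ => exact fun _ => ⟨.neg .bot, (p.mem_iff_sat hp _).2 id, fun _ _ => trivial⟩
      | inter U V _ _ ihU ihV =>
        rintro ⟨hpU, hpV⟩
        obtain ⟨φ, h1, h2⟩ := ihU hpU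
        obtain ⟨ψ, h3, h4⟩ := ihV hpV
        refine ⟨φ.and ψ, (p.mem_iff_sat hp _).2 ⟨hp φ h1, hp ψ h3⟩, fun q hq => ?_⟩
        obtain ⟨N, hN, w, hw, hq'⟩ := q.2.2
        exact ⟨h2 q ((q.mem_iff_sat hq' _).2 (hq' _ hq).1),
          h4 q ((q.mem_iff_sat hq' _).2 (hq' _ hq).2)⟩
      | sUnion 𝒰 _ ih =>
        rintro ⟨U, hU, hpU⟩
        obtain ⟨φ, h1, h2⟩ := ih U hU hpU
        exact ⟨φ, h1, fun q hq => ⟨U, hU, h2 q hq⟩⟩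
    intro h
    obtain ⟨φ, h1, h2⟩ := key _ h rfl
    refine ⟨φ, h1, fun N hN w hw hφ ψ hψ => ?_⟩
    rw [← Set.mem_singleton_iff.1 (h2 (of hN hw) hφ)] at hψ
    exact hψ
  · rintro ⟨φ, h1, h2⟩
    have : ({p} : Set (TypeSpace.{uf, ur, u} T X)) = {q | φ ∈ q.1} := by
      refine Set.Subset.antisymm ?_ fun q hq => ?_
      · rintro _ rfl
        exact h1
      · obtain ⟨M, hM, v, hv, hq'⟩ := q.2.2
        have h3 := h2 M hM v hv (hq' φ hq)
        exact Subtype.ext (Set.ext fun ψ =>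
          (q.mem_iff_sat hq' ψ).trans (p.mem_iff_sat h3 ψ).symm)
    rw [this]
    exact .basic _ ⟨φ, rfl⟩

/-- In a complete theory, isolated types are realized in all models, as the formula that isolates
the type is satisfiable by a sentence of the theory. -/
theorem realizes_of_isOpen (hT : CompleteTheory.{uf, ur, u} T) {p : TypeSpace.{uf, ur, u} T X}
    (hp : IsOpen {p}) {M : ProtoStructure.{uf, ur, u} L} (hM : M.IsModel T) : M.Realizes p.1 := by
  obtain ⟨φ, hφ, hiso⟩ := p.isOpen_singleton_iff.1 hp
  obtain ⟨N, hN, w, hw, hwp⟩ := p.2.2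
  have : Nonempty X := by
    obtain ⟨a⟩ := hN.1.nonempty
    exact ((N.coval hw).cosurj a).nonempty
  have htrue := coBijective_true (X := starCtx) (Y := X)
  rcases hT (.ex _ htrue φ) with h | h
  · obtain ⟨-, v₀, hv₀, hσ⟩ := h M hM
    obtain ⟨v, hv, -, hvφ⟩ := hσ _ rfl
    exact ⟨v, hv, hiso M hM v hv hvφ⟩
  · obtain ⟨-, v₀, hv₀, hσ⟩ := h N hN
    refine absurd ⟨w, hw, ?_, hwp φ hφ⟩ (hσ _ rfl)
    rw [(N.coval hv₀).eq_star, (htrue.comp (N.coval hw)).eq_star]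

end TypeSpace

/-! ### Realizing and omitting types -/

theorem exists_coBijective {X Y : Type*} [Nonempty X] [Finite X] [Finite Y]
    (h : Nat.card X ≤ Nat.card Y) : ∃ r : X → Y → Prop, CoBijective r := by
  have : Nonempty Y := Finite.card_pos_iff.1 (Nat.card_pos.trans_le h)
  obtain ⟨s, t, -, ht, -⟩ := (coBijective_true (X := Unit) (Y := Y)).interpolate (Y := X)
    (by rw [Nat.card_unique]; exact Nat.card_pos) h
  exact ⟨t, ht⟩

/-- A model of `T` yields a condition that imposes no restriction. -/
theorem exists_cond {T : Set (Formula L starCtx)} {M : ProtoStructure.{uf, ur, u} L}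
    (hM : M.IsModel T) : ∃ q : Cond.{uf, ur, u} T, ∃ v ∈ M.V (level q.j), M.Sat q.ψ v := by
  choose g hg using fun i => exists_coBijective (X := level i) (Y := level (i + 1))
    (by simpa only [card_level] using (levelCard_lt i).le)
  obtain ⟨-, v, hv, -⟩ := id hM
  have h := M.closed _ (coBijective_true (X := level 0)) hv
  exact ⟨⟨0, g, hg, .neg .bot, M, hM, _, h, id⟩, _, h, id⟩

variable [L.IsRelational]

/-- Every condition is realized by a code in `Mod*(T)`, which moreover meets countably many given
dense requirements. -/
theorem exists_code [Countable (Σ m, L.Relations m)] {T : Set (Formula L starCtx)}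
    (hinf : ∀ M : ProtoStructure.{uf, ur, u} L, M.IsCompactOmegaModel T → Infinite M.carrier)
    (q₀ : Cond.{uf, ur, u} T) {ι : Type} [Countable ι] (D : ι → Cond.{uf, ur, u} T → Prop)
    (hD : ∀ i q, ∃ q', Cond.Ext q' q ∧ D i q') :
    ∃ μ ∈ ModExact L, μ.model.IsCompactOmegaModel T ∧
      (∀ a b, b ≤ q₀.j → link μ.ge a b = link q₀.g.ge a b) ∧
      (∀ {X : Finset ℕ} {i : ℕ} {r : X → level i → Prop} {φ : Formula L X}, CoBijective r →
        q₀.Forces r φ → μ.model.Sat φ (Comp r (μ.core i))) ∧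
      ∀ k, ∃ q, D k q ∧ ∀ {X : Finset ℕ} {i : ℕ} {r : X → level i → Prop} {φ : Formula L X},
        CoBijective r → q.Forces r φ → μ.model.Sat φ (Comp r (μ.core i)) := by
  obtain ⟨q, rfl, hq, hqD⟩ := exists_generic hinf q₀ D hD
  refine ⟨hq.code, hq.code_mem_modExact, hq.model_isCompactOmegaModel, fun a b hb => ?_,
    fun hr hf => (hq.sat_iff_forced _ hr).2 ⟨0, hf⟩, fun k => ?_⟩
  · exact Bonds.link_congr fun k _ hk => (hq.bonds_eq (hk.trans_le hb)).symm
  · obtain ⟨n, hn⟩ := hqD k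
    exact ⟨q n, hn, fun hr hf => (hq.sat_iff_forced _ hr).2 ⟨n, hf⟩⟩

/-- A type that is not isolated is omitted in some compact `ω`-model: its negation can be forced
formula by formula at every consolidation of a member of the core. -/
theorem isOpen_of_forall_realizes [Countable (Σ m, L.Relations m)] {T : Set (Formula L starCtx)}
    (hinf : ∀ M : ProtoStructure.{uf, ur, u} L, M.IsCompactOmegaModel T → Infinite M.carrier)
    {X : Finset ℕ} (p : TypeSpace.{uf, ur, u} T X)
    (h : ∀ M : ProtoStructure.{uf, ur, u} L, M.IsCompactOmegaModel T → M.Realizes p.1) :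
    IsOpen {p} := by
  by_contra hp
  obtain ⟨M, hM, -⟩ := p.2.2
  obtain ⟨q₀, -⟩ := exists_cond hM
  obtain ⟨μ, hμ, hcomp, -, -, hD⟩ := exists_code hinf q₀
    (fun (c : Σ i, {r : X → level i → Prop // CoBijective r}) q => ∃ θ ∈ p.1, q.Forces c.2.1 θ.neg)
    (by
      rintro ⟨i, r, hr⟩ q
      obtain ⟨q', hq', hi⟩ := Cond.exists_ext_level hinf q i
      suffices ∃ M : ProtoStructure.{uf, ur, u} L, M.IsModel T ∧ ∃ v ∈ M.V (level q'.j),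
          M.Sat q'.ψ v ∧ ∃ θ ∈ p.1, ¬ M.Sat θ (Comp (Comp r (link q'.g.ge i q'.j)) v) by
        obtain ⟨M, hM, v, hv, hs, θ, hθ, hn⟩ := this
        obtain ⟨q'', h1, h2⟩ := q'.exists_ext_forces hi hr θ.neg hM hv hs hn
        exact ⟨q'', h1.trans hq', θ, hθ, h2⟩
      by_contra! hcon
      -- Otherwise, the existential closure of the formula of the condition isolates the type.
      obtain ⟨M, hM, v, hv, hs⟩ := q'.con
      refine hp (p.isOpen_singleton_iff.2
        ⟨.ex _ (hr.comp (q'.g.coBijective_link q'.hg hi)) q'.ψ, ?_, ?_⟩)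
      · exact (p.mem_iff_sat (hcon M hM v hv hs) _).2 ⟨v, hv, rfl, hs⟩
      · rintro N hN _ - ⟨w, hw, rfl, hws⟩
        exact hcon N hN w hw hws)
  obtain ⟨v, ⟨-, i, r, hr, hv⟩, hvp⟩ := h _ hcomp.lift
  obtain ⟨q, ⟨θ, hθ, hqθ⟩, hsat⟩ := hD ⟨i, r, hr⟩
  refine hsat hr hqθ ?_
  have := (μ.model.sat_lift θ fun x a => v x ⟨a⟩).1 (hvp θ hθ)
  rw [hv] at this
  exact this

/-- An isolated type is realized throughout the non-empty basic open set of codes given by the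
formula that isolates it. -/
theorem somewhereRealized_of_isOpen [Countable (Σ m, L.Relations m)]
    {T : Set (Formula L starCtx)}
    (hinf : ∀ M : ProtoStructure.{uf, ur, u} L, M.IsCompactOmegaModel T → Infinite M.carrier)
    {K : Set (Code L)} (hK : ModExact L ⊆ K) (hK' : K ⊆ Mod L)
    {X : Finset ℕ} (p : TypeSpace.{uf, ur, u} T X) (hp : IsOpen {p}) :
    SomewhereRealized K T p.1 := by
  obtain ⟨φ, hφ, hiso⟩ := p.isOpen_singleton_iff.1 hp
  obtain ⟨M, hM, w, hw, hwp⟩ := p.2.2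
  obtain ⟨q, v, hv, hs⟩ := exists_cond hM
  obtain ⟨j, g, v', t, -, hj, hg, -, hv', -, ht, rfl⟩ :=
    Cond.exists_continuation hinf q hM hv hw 0
  obtain ⟨μ, hμ, hcomp, -, hf, -⟩ := exists_code hinf
    ⟨j, g, hg, subst.{uf, ur, u} ht φ, M, hM, v', hv', (sat_subst hM.1 ht φ hv').2 (hwp φ hφ)⟩
    (fun (i : Empty) _ => i.elim) fun i => i.elim
  have hμφ : μ.model.Sat φ (Comp t (μ.core j)) := hf ht
    ⟨le_rfl, fun N hN u hu h => by
      rw [Bonds.link_self, comp_eq]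
      exact (sat_subst hN.1 ht φ hu).1 h⟩
  have hsub : ∀ ν ∈ ModelsIn K T, ν.model.Sat (subst.{uf, ur, 0} ht φ) (ν.core j) ↔
      ν.model.Sat φ (Comp t (ν.core j)) := fun ν hν =>
    sat_subst hν.2.1 ht φ (Code.core_mem (hK' hν.1).chain j)
  refine ⟨j, t, ht, ⟨μ, hK hμ, hcomp.1⟩, mem_interior.2
    ⟨{ν | ν.1.model.Sat (subst.{uf, ur, 0} ht φ) (ν.1.core j)}, fun ν hν ψ hψ => ?_, ?_, ?_⟩⟩
  · have h1 := (ν.1.model.sat_lift φ _).2 ((hsub ν.1 ν.2).1 hν)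
    exact (ν.1.model.sat_lift ψ _).1 (hiso _ ν.2.2.lift _
      (Code.comp_core_mem (hK' ν.2.1).chain ht) h1 ψ hψ)
  · have hopen : IsOpen {ν : Code L | ν.model.Sat (subst.{uf, ur, 0} ht φ) (ν.core j)} :=
      .basic _ (.inr ⟨j, _, rfl⟩)
    exact hopen.preimage continuous_subtype_val
  · exact (hsub μ ⟨hK hμ, hcomp.1⟩).2 hμφ

/-- Near a code `μ`, the logic topology is controlled by the order up to some level `j` and a single
formula at the `j`-th member of the core; `j` can be chosen arbitrarily large. -/
theorem exists_basic_nhd {μ : Code L} (hμ : μ.IsCode) (hμs : μ.model.IsStructure)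
    {U : Set (Code L)} (hU : IsOpen U) (hμU : μ ∈ U) :
    ∃ N, ∀ j, N ≤ j → ∃ ψ : Formula L (level j), μ.model.Sat ψ (μ.core j) ∧
      ∀ ν : Code L, ν.IsCode → ν.model.IsStructure →
        (∀ a b, b ≤ j → link ν.ge a b = link μ.ge a b) → ν.model.Sat ψ (ν.core j) → ν ∈ U := by
  induction hU with
  | basic U hU =>
    rcases hU with ⟨i, g, rfl⟩ | ⟨i, φ, rfl⟩
    · refine ⟨i, fun j hj => ⟨.neg .bot, id, fun ν _ _ hag _ x y hx hy => ?_⟩⟩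
      have := congrFun₂ (hag x.1 y.1 (hy.trans hj)) x.2 y.2
      exact (iff_of_eq this).trans (hμU x y hx hy)
    · refine ⟨i, fun j hj => ?_⟩
      have hl := hμ.chain.coBijective_link hj
      have key : ∀ ν : Code L, ν.IsCode → ν.model.IsStructure →
          link ν.ge i j = link μ.ge i j →
          (ν.model.Sat (subst.{uf, ur, 0} hl φ) (ν.core j) ↔ ν.model.Sat φ (ν.core i)) := by
        intro ν hν hνs hag
        refine (sat_subst hνs hl φ (Code.core_mem hν.chain j)).trans
          (iff_of_eq (congrArg (ν.model.Sat φ) ?_))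
        exact (congrArg (Comp · (ν.core j)) hag.symm).trans (Code.core_eq_comp hν.chain hj).symm
      exact ⟨subst.{uf, ur, 0} hl φ, (key μ hμ hμs rfl).2 hμU,
        fun ν hν hνs hag h => (key ν hν hνs (hag i j le_rfl)).1 h⟩
  | univ => exact ⟨0, fun j _ => ⟨.neg .bot, id, fun _ _ _ _ _ => trivial⟩⟩
  | inter U V _ _ ihU ihV =>
    obtain ⟨N, hN⟩ := ihU hμU.1
    obtain ⟨N', hN'⟩ := ihV hμU.2
    refine ⟨max N N', fun j hj => ?_⟩
    obtain ⟨ψ, h1, h2⟩ := hN j ((le_max_left _ _).trans hj)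
    obtain ⟨ψ', h1', h2'⟩ := hN' j ((le_max_right _ _).trans hj)
    exact ⟨ψ.and ψ', ⟨h1, h1'⟩, fun ν hν hνs hag h =>
      ⟨h2 ν hν hνs hag h.1, h2' ν hν hνs hag h.2⟩⟩
  | sUnion 𝒰 _ ih =>
    obtain ⟨U, hU, hμU⟩ := hμU
    obtain ⟨N, hN⟩ := ih U hU hμU
    refine ⟨N, fun j hj => ?_⟩
    obtain ⟨ψ, h1, h2⟩ := hN j hj
    exact ⟨ψ, h1, fun ν hν hνs hag h => ⟨U, hU, h2 ν hν hνs hag h⟩⟩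

/-- If a type is realized throughout a basic open set of codes, then the existential closure of the
formula describing this set isolates the type: a model containing a counterexample would yield a
code in the open set where the type is not realized. -/
theorem isOpen_of_somewhereRealized [Countable (Σ m, L.Relations m)]
    {T : Set (Formula L starCtx)}
    (hinf : ∀ M : ProtoStructure.{uf, ur, u} L, M.IsCompactOmegaModel T → Infinite M.carrier)
    {K : Set (Code L)} (hK : ModExact L ⊆ K) (hK' : K ⊆ Mod L)
    {X : Finset ℕ} (p : TypeSpace.{uf, ur, u} T X) (hp : SomewhereRealized K T p.1) :
    IsOpen {p} := by
  obtain ⟨i, r, hr, ⟨μ, hμK, hμT⟩, hμi⟩ := hp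
  obtain ⟨U, hU, hUi⟩ := isOpen_induced_iff.1 (isOpen_interior (s := {μ : ModelsIn K T |
      ∀ φ ∈ p.1, μ.1.model.Sat φ (Comp r (μ.1.core i))}))
  have hUr : ∀ ν (hν : ν ∈ ModelsIn K T), ν ∈ U → ∀ φ ∈ p.1,
      ν.model.Sat φ (Comp r (ν.core i)) := by
    intro ν hν hνU
    have h : (⟨ν, hν⟩ : ModelsIn K T) ∈ Subtype.val ⁻¹' U := hνU
    rw [hUi] at h
    exact interior_subset h
  have hμU : μ ∈ U := by
    rw [← hUi] at hμi
    exact hμi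
  have hμ := hK' hμK
  obtain ⟨N, hN⟩ := exists_basic_nhd hμ hμT.1 hU hμU
  obtain ⟨j, hNj, hij⟩ : ∃ j, N ≤ j ∧ i ≤ j := ⟨max N i, le_max_left N i, le_max_right N i⟩
  obtain ⟨ψ, h1, h2⟩ := hN j hNj
  have hge := hμ.chain.eq_ge
  have hrl := hr.comp (hμ.chain.coBijective_link hij)
  refine p.isOpen_singleton_iff.2 ⟨.ex _ hrl ψ, ?_, ?_⟩
  · have hreal : ∀ φ ∈ p.1, (μ.model.lift : ProtoStructure.{uf, ur, u} L).Sat φ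
        (fun x a => Comp r (μ.core i) x a.down) := fun φ hφ =>
      (μ.model.sat_lift φ _).2 (hUr μ ⟨hμK, hμT⟩ hμU φ hφ)
    refine (p.mem_iff_sat hreal _).2 ((μ.model.sat_lift _ _).2
      ⟨μ.core j, Code.core_mem hμ.chain j, ?_, h1⟩)
    exact (congrArg (Comp r) (Code.core_eq_comp hμ.chain hij)).trans comp_assoc.symm
  · rintro M hM _ - ⟨w, hw, rfl, hwψ⟩ θ hθ
    by_contra hn
    let q₁ : Cond.{uf, ur, u} T :=
      ⟨j, fun i => link μ.ge i (i + 1), hμ.chain.2, ψ, M, hM, w, hw, hwψ⟩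
    obtain ⟨q₀, hq₀, hq₀θ⟩ := q₁.exists_ext_forces hij hr θ.neg hM hw hwψ (by rwa [hge] at hn)
    obtain ⟨ν, hν, hνT, hag, hf, -⟩ := exists_code hinf q₀
      (fun (i : Empty) _ => i.elim) fun i => i.elim
    have hνψ : ν.model.Sat ψ (ν.core j) := by
      have : q₁.Forces (Eq : level j → level j → Prop) ψ := ⟨le_rfl, fun N hN v hv h => by
        rwa [eq_comp, Bonds.link_self, eq_comp]⟩
      exact (iff_of_eq (congrArg (ν.model.Sat ψ) eq_comp)).1 (hf .eq (this.mono hq₀))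
    refine hf hr hq₀θ (hUr ν ⟨hK hν, hνT.1⟩ (h2 ν hν.1 hνT.1.1 (fun a b hb => ?_) hνψ) θ hθ)
    rw [hag a b (hb.trans hq₀.1), hge]
    exact Bonds.link_congr fun k _ hk => hq₀.2.1 k (hk.trans_le hb)

end CovLogic

theorem mainTheorem7 {L : FirstOrder.Language.{uf, ur}} [L.IsRelational]
    [Countable (Σ m, L.Relations m)] (T : Set (CovLogic.Formula L CovLogic.starCtx))
    (hinf : ∀ M : CovLogic.ProtoStructure.{uf, ur, u} L,
      M.IsCompactOmegaModel T → Infinite M.carrier)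
    (X : Finset ℕ) (p : CovLogic.TypeSpace.{uf, ur, u} T X) :
    (CovLogic.CompleteTheory.{uf, ur, u} T →
      List.TFAE [
        IsOpen ({p} : Set (CovLogic.TypeSpace.{uf, ur, u} T X)),
        ∀ M : CovLogic.ProtoStructure.{uf, ur, u} L, M.IsModel T → M.Realizes p.1,
        ∀ M : CovLogic.ProtoStructure.{uf, ur, u} L, M.IsCompactOmegaModel T → M.Realizes p.1,
        CovLogic.SomewhereRealized (CovLogic.Mod L) T p.1,
        CovLogic.SomewhereRealized (CovLogic.ModExact L) T p.1]) ∧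
    List.TFAE [
      IsOpen ({p} : Set (CovLogic.TypeSpace.{uf, ur, u} T X)),
      CovLogic.SomewhereRealized (CovLogic.Mod L) T p.1,
      CovLogic.SomewhereRealized (CovLogic.ModExact L) T p.1] ∧
    ((∀ M : CovLogic.ProtoStructure.{uf, ur, u} L, M.IsCompactOmegaModel T → M.Realizes p.1) →
      IsOpen ({p} : Set (CovLogic.TypeSpace.{uf, ur, u} T X))) := by
  have hK : CovLogic.ModExact L ⊆ CovLogic.Mod L := fun _ h => h.1
  have h13 := CovLogic.somewhereRealized_of_isOpen hinf hK subset_rfl p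
  have h31 := CovLogic.isOpen_of_somewhereRealized hinf hK subset_rfl p
  have h13' := CovLogic.somewhereRealized_of_isOpen hinf subset_rfl hK p
  have h31' := CovLogic.isOpen_of_somewhereRealized hinf subset_rfl hK p
  have h21 := CovLogic.isOpen_of_forall_realizes hinf p
  refine ⟨fun hT => ?_, ?_, h21⟩
  · tfae_have 1 → 2 := fun h M hM => CovLogic.TypeSpace.realizes_of_isOpen hT h hM
    tfae_have 2 → 3 := fun h M hM => h M hM.1
    tfae_have 3 → 1 := h21
    tfae_have 1 → 4 := h13
    tfae_have 4 → 1 := h31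
    tfae_have 1 → 5 := h13'
    tfae_have 5 → 1 := h31'
    tfae_finish
  · tfae_have 1 → 2 := h13
    tfae_have 2 → 1 := h31
    tfae_have 1 → 3 := h13'
    tfae_have 3 → 1 := h31'
    tfae_finish
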